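/- Let $\mathbb N\sqcup\overline{\mathbb N}$ be totally ordered by $i\prec\overline i\prec i+1$, and let $I\subset\mathbb N$, $\overline J\subset\overline{\mathbb N}$ be nonempty finite sets with $\min(I\sqcup\overline J)\in I$ and $\max(I\sqcup\overline J)\in\overline J$. Put $(i_0,\overline j_0)=(\min I,\max\overline J)$. An $(I,\overline J)$-forest is a set $F$ of arcs $(i,\overline j)\in I\times\overline J$ with $i\prec\overline j$ that contains no two arcs $(i,\overline j),(i',\overline j')$ with $i\prec i'\prec\overline j\prec\overline j'$; it is covering if $(i_0,\overline j_0)\in F$ and every element of $I\sqcup\overline J$ is an endpoint of an arc of $F$. The $(I,\overline J)$-Tamari complex $\mathcal A_{I,\overline J}$ is the simplicial complex of $(I,\overline J)$-forests. For a set $S$ of nodes write $\mathcal A_S:=\mathcal A_{I\cap S,\overline J\cap S}$. Let $\mathcal K\setminus v$ denote the deletion of $v$ from a complex $\mathcal K$, and $*$ the join; in the second factor on the left of (1), $F$ stands for the full simplex on $F$. The boundary complex of the simplicial $d$-dimensional associahedron ($d\ge0$) is the complex of non-crossing sets of inner diagonals of a convex $(d+3)$-gon; a classical $d$-dimensional associahedron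 is a convex polytope whose poset of nonempty faces is anti-isomorphic to the face poset (empty face included) of that complex. A height function $h$ assigning a real number to every $(i,\overline j)\in I\times\overline J$ with $i\prec\overline j$ is non-crossing if $h(i,\overline j')+h(i',\overline j)<h(i,\overline j)+h(i',\overline j')$ whenever $i\prec i'\prec\overline j\prec\overline j'$; set $h(i,\overline j)=\infty$ if $\overline j\prec i$. For such $h$, the $(I,\overline J)$-associahedron $\operatorname{Asso}_{I,\overline J}(h)$ is the complex of bounded cells induced in $\{x\in\mathbb R^{\overline J}: x_{\overline j_0}=0\}$ by the inverted tropical hyperplanes $$H_i=\{x:\max_{\overline j\in\overline J}(-h(i,\overline j)+x_{\overline j})\text{ is attained at least twice}\},\qquad i\in I.$$ That is, its cells are the nonempty bounded sets obtained by intersecting regions $\{x:\text{the maximum for } i \text{ is attained at }\overline j\}$, with at least one region for every $i\in I$. Then the following hold. 1. For every $(I,\overline J)$-forest $F$, $$\operatorname{link}_{\mathcal A_{I,\overline J}}(F)*F\;\cong\;\Bigl(\mathop{\ast}_{(i,\overline j)\in F,\ (i,\overline j)\ne(i_0,\overline j_0)}\mathcal A_{S_{(i,\overline j)}}\setminus(i,\overline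 j)\Bigr)*\mathcal A_{S_{(i_0,\overline j_0)}},\tag{1}$$ where $S_{(i,\overline j)}=[i,\overline j]\setminus\bigcup\{\,]i',\overline j'[\;:(i',\overline j')\in F,\ [i',\overline j']\subsetneq[i,\overline j]\}$. 2. For every arc $(i,\overline j)\in I\times\overline J$ with $i\prec\overline j$, $\operatorname{link}_{\mathcal A_{I,\overline J}}(\{(i,\overline j)\})$ is isomorphic to the join of $\mathcal A_{[i,\overline j]}\setminus(i,\overline j)$ and $\mathcal A_{S}\setminus(i,\overline j)$, where $S$ is the complement of $]i,\overline j[$. 3. For every covering $(I,\overline J)$-forest $F$, $\operatorname{link}_{\mathcal A_{I,\overline J}}(F)$ is isomorphic to the join of a finite family of boundary complexes of simplicial associahedra. 4. For every non-crossing height function $h$, every cell of $\operatorname{Asso}_{I,\overline J}(h)$ is a convex polytope that is combinatorially isomorphic (i.e. has an isomorphic face poset) to a Cartesian product of finitely many classical associahedra. -/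

import Mathlib

namespace TamariAssoc

/-! ### Simplicial complexes

We use Mathlib's `PreAbstractSimplicialComplex`, whose faces are the *nonempty* faces; the empty
face, which every complex below has, is left implicit. In particular `⊥` is the complex `{∅}`. -/

section Complexes

variable {V W : Type*}

/-- The simplicial complex whose faces are the nonempty members of a family of finite sets that is
closed under passing to subsets. -/
def ofFaces (P : Finset V → Prop) (hP : ∀ s t, t ⊆ s → P s → P t) :
    PreAbstractSimplicialComplex V where
  faces := {s | s.Nonempty ∧ P s}
  isRelLowerSet_faces := fun {s} hs => ⟨hs.1, fun t hts ht => ⟨ht, hP s t hts hs.2⟩⟩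

/-- `s` is the empty face or a nonempty face of `K`. -/
def IsFace (K : PreAbstractSimplicialComplex V) (s : Finset V) : Prop := s = ∅ ∨ s ∈ K.faces

theorem IsFace.mono {K : PreAbstractSimplicialComplex V} {s t : Finset V}
    (hs : IsFace K s) (hts : t ⊆ s) : IsFace K t := by
  rcases t.eq_empty_or_nonempty with rfl | ht
  · exact Or.inl rfl
  · rcases hs with rfl | hs
    · exact absurd (Finset.subset_empty.1 hts) ht.ne_empty
    · exact Or.inr ((K.isRelLowerSet_faces hs).2 hts ht)

/-- The poset of all faces, the empty one included, ordered by inclusion. -/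
abbrev FacePoset (K : PreAbstractSimplicialComplex V) : Type _ := {s : Finset V // IsFace K s}

/-- The elements of the ground type that are vertices of the complex. -/
abbrev Vertices (K : PreAbstractSimplicialComplex V) : Type _ := {v : V // {v} ∈ K.faces}

/-- Isomorphism of simplicial complexes: a bijection between the vertex sets under which faces
correspond to faces. -/
def Isomorphic (K : PreAbstractSimplicialComplex V) (L : PreAbstractSimplicialComplex W) : Prop :=
  ∃ e : Vertices K ≃ Vertices L, ∀ s : Finset (Vertices K),
    s.map (Function.Embedding.subtype _) ∈ K.faces ↔
      (s.map e.toEmbedding).map (Function.Embedding.subtype _) ∈ L.faces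

/-- The link of `F` in `K`: the sets `G \ F` for the faces `G` of `K` that contain `F`. -/
def link [DecidableEq V] (K : PreAbstractSimplicialComplex V) (F : Finset V) :
    PreAbstractSimplicialComplex V :=
  ofFaces (fun s => ∃ G, IsFace K G ∧ F ⊆ G ∧ s = G \ F) <| by
    rintro s t hts ⟨G, hG, hF, rfl⟩
    refine ⟨t ∪ F, hG.mono (Finset.union_subset (hts.trans Finset.sdiff_subset) hF),
      Finset.subset_union_right, ?_⟩
    ext x
    have := @hts x
    simp only [Finset.mem_sdiff, Finset.mem_union] at this ⊢
    tauto

/-- The deletion `K \ v`. -/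
def deletion (K : PreAbstractSimplicialComplex V) (v : V) : PreAbstractSimplicialComplex V :=
  ofFaces (fun s => IsFace K s ∧ v ∉ s) fun _ _ hts hs => ⟨hs.1.mono hts, fun h => hs.2 (hts h)⟩

/-- The full simplex on the vertex set `F`. -/
def fullSimplex (F : Finset V) : PreAbstractSimplicialComplex V :=
  ofFaces (fun s => s ⊆ F) fun _ _ hts hs => hts.trans hs

/-- The join of two complexes, on the disjoint union of the ground types. -/
def join (K : PreAbstractSimplicialComplex V) (L : PreAbstractSimplicialComplex W) :
    PreAbstractSimplicialComplex (V ⊕ W) :=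
  ofFaces (fun s => IsFace K s.toLeft ∧ IsFace L s.toRight) fun _ _ hts hs =>
    ⟨hs.1.mono (Finset.toLeft_subset_toLeft hts), hs.2.mono (Finset.toRight_subset_toRight hts)⟩

/-- The part of `s` that lies in the summand `k` of a disjoint union of types. -/
noncomputable def slice {ι : Type*} {X : ι → Type*} (s : Finset (Σ k, X k)) (k : ι) :
    Finset (X k) :=
  s.preimage (Sigma.mk k) sigma_mk_injective.injOn

/-- The join of a family of complexes, on the disjoint union of the ground types. -/
def iJoin {ι : Type*} {X : ι → Type*} (K : ∀ k, PreAbstractSimplicialComplex (X k)) :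
    PreAbstractSimplicialComplex (Σ k, X k) :=
  ofFaces (fun s => ∀ k, IsFace (K k) (slice s k)) fun s t hts hs k =>
    (hs k).mono fun x hx => by
      simp only [slice, Finset.mem_preimage] at hx ⊢
      exact hts hx

end Complexes

/-! ### Forests and Tamari complexes -/

/-- The totally ordered set `ℕ ⊔ ℕ̄` with `i ≺ ī ≺ i + 1`. -/
abbrev Node : Type := ℕ ×ₗ Bool

/-- The node `i` of `ℕ`. -/
def bl (i : ℕ) : Node := toLex (i, false)

/-- The node `j̄` of `ℕ̄`. -/
def wh (j : ℕ) : Node := toLex (j, true)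

theorem bl_lt_bl {i k : ℕ} : bl i < bl k ↔ i < k := by
  simp [bl, Prod.Lex.toLex_lt_toLex]

theorem wh_lt_wh {i k : ℕ} : wh i < wh k ↔ i < k := by
  simp [wh, Prod.Lex.toLex_lt_toLex]

theorem bl_lt_wh {i k : ℕ} : bl i < wh k ↔ i ≤ k := by
  simp [bl, wh, Prod.Lex.toLex_lt_toLex, le_iff_lt_or_eq]

/-- A pair `(i, j)` stands for the arc `(i, j̄)`. The arcs `(i, j̄)` and `(i', j̄')` cross, in this
order, if `i ≺ i' ≺ j̄ ≺ j̄'`. -/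
def Crossing (a b : ℕ × ℕ) : Prop := bl a.1 < bl b.1 ∧ bl b.1 < wh a.2 ∧ wh a.2 < wh b.2

/-- `(I, J̄)`-forests: increasing non-crossing subgraphs of the complete bipartite graph on
`I ⊔ J̄`, given by their sets of arcs. -/
structure IsForest (I J : Finset ℕ) (F : Finset (ℕ × ℕ)) : Prop where
  subset : F ⊆ I ×ˢ J
  increasing : ∀ a ∈ F, bl a.1 < wh a.2
  nonCrossing : ∀ a ∈ F, ∀ b ∈ F, ¬ Crossing a b

/-- The `(I, J̄)`-Tamari complex: the simplicial complex of `(I, J̄)`-forests. -/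
def tamariComplex (I J : Finset ℕ) : PreAbstractSimplicialComplex (ℕ × ℕ) :=
  ofFaces (IsForest I J) fun _ _ hts hs =>
    ⟨hts.trans hs.subset, fun a ha => hs.increasing a (hts ha),
      fun a ha b hb => hs.nonCrossing a (hts ha) b (hts hb)⟩

/-- The arc `(min I, max J̄)`. -/
def rootArc (I J : Finset ℕ) (hI : I.Nonempty) (hJ : J.Nonempty) : ℕ × ℕ :=
  (I.min' hI, J.max' hJ)

/-- Covering forests: forests that contain `(min I, max J̄)` and have no isolated node. -/
structure IsCoveringForest (I J : Finset ℕ) (hI : I.Nonempty) (hJ : J.Nonempty)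
    (F : Finset (ℕ × ℕ)) : Prop extends IsForest I J F where
  root_mem : rootArc I J hI hJ ∈ F
  left_covered : ∀ i ∈ I, ∃ j, (i, j) ∈ F
  right_covered : ∀ j ∈ J, ∃ i, (i, j) ∈ F

/-- The closed interval `[i, j̄]` of `ℕ ⊔ ℕ̄`. -/
def closedInterval (a : ℕ × ℕ) : Set Node := Set.Icc (bl a.1) (wh a.2)

/-- The open interval `]i, j̄[` of `ℕ ⊔ ℕ̄`. -/
def openInterval (a : ℕ × ℕ) : Set Node := Set.Ioo (bl a.1) (wh a.2)

/-- The set `[i, j̄]` minus all `]i', j̄'[` for `(i', j̄') ∈ F` with `[i', j̄'] ⊊ [i, j̄]`. -/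
def region (F : Finset (ℕ × ℕ)) (a : ℕ × ℕ) : Set Node :=
  closedInterval a \ {x | ∃ b ∈ F, closedInterval b ⊂ closedInterval a ∧ x ∈ openInterval b}

open Classical in
/-- The Tamari complex of the restrictions of `I` and `J̄` to a set `S` of nodes. -/
noncomputable def tamariOn (I J : Finset ℕ) (S : Set Node) :
    PreAbstractSimplicialComplex (ℕ × ℕ) :=
  tamariComplex {i ∈ I | bl i ∈ S} {j ∈ J | wh j ∈ S}

/-! ### Classical associahedra -/

/-- The pair `(a, b)` of vertices `a < b` is an inner diagonal of the convex `N`-gon with vertices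
`0, 1, …, N - 1` in cyclic order. -/
def IsInnerDiagonal (N : ℕ) (a : ℕ × ℕ) : Prop :=
  a.1 + 1 < a.2 ∧ a.2 < N ∧ a ≠ (0, N - 1)

/-- The boundary complex of the simplicial `d`-dimensional associahedron: the complex of pairwise
non-crossing sets of inner diagonals of a convex `(d + 3)`-gon. -/
def simplicialAssociahedronBoundary (d : ℕ) : PreAbstractSimplicialComplex (ℕ × ℕ) :=
  ofFaces (fun D => (∀ a ∈ D, IsInnerDiagonal (d + 3) a) ∧
      ∀ a ∈ D, ∀ b ∈ D, ¬ (a.1 < b.1 ∧ b.1 < a.2 ∧ a.2 < b.2)) fun _ _ hts hs =>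
    ⟨fun a ha => hs.1 a (hts ha), fun a ha b hb => hs.2 a (hts ha) b (hts hb)⟩

section Polytopes

variable {E E' : Type*} [AddCommGroup E] [Module ℝ E] [TopologicalSpace E]
  [AddCommGroup E'] [Module ℝ E'] [TopologicalSpace E']

/-- Convex polytopes: convex hulls of finite nonempty sets of points. -/
def IsPolytope (P : Set E) : Prop :=
  ∃ s : Set E, s.Finite ∧ s.Nonempty ∧ P = convexHull ℝ s

/-- The poset of nonempty faces of a polytope (the polytope itself included), ordered by
inclusion. -/
abbrev PolytopeFaces (P : Set E) : Type _ := {B : Set E // B.Nonempty ∧ IsExposed ℝ P B}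

/-- Two polytopes are combinatorially isomorphic if their face posets are isomorphic. -/
def CombinatoriallyIsomorphic (P : Set E) (Q : Set E') : Prop :=
  Nonempty (PolytopeFaces P ≃o PolytopeFaces Q)

/-- Classical (simple) `d`-dimensional associahedra: polytopes whose faces correspond, with
inclusions reversed, to the non-crossing sets of inner diagonals of a convex `(d + 3)`-gon. -/
def IsAssociahedron (d : ℕ) (P : Set E) : Prop :=
  IsPolytope P ∧
    Nonempty (PolytopeFaces P ≃o (FacePoset (simplicialAssociahedronBoundary d))ᵒᵈ)

end Polytopes

/-! ### The `(I, J̄)`-associahedron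

The height function `h` is only ever evaluated at pairs with `i ≺ j̄`; it is understood to be `∞` at
all other pairs. -/

/-- Non-crossing height functions. -/
def IsNonCrossingHeight (I J : Finset ℕ) (h : ℕ → ℕ → ℝ) : Prop :=
  ∀ i ∈ I, ∀ i' ∈ I, ∀ j ∈ J, ∀ j' ∈ J, bl i < bl i' → bl i' < wh j → wh j < wh j' →
    h i j' + h i' j < h i j + h i' j'

/-- The indices `j̄ ∈ J̄` at which the maximum of the `- h (i, j̄) + x_j̄` is attained. -/
def argmax (J : Finset ℕ) (h : ℕ → ℕ → ℝ) (i : ℕ) (x : J → ℝ) : Set J :=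
  {j | bl i < wh j ∧ ∀ k : J, bl i < wh k → - h i k + x k ≤ - h i j + x j}

/-- The inverted tropical hyperplane `H_i`, in homogeneous coordinates. -/
def tropicalHyperplane (J : Finset ℕ) (h : ℕ → ℕ → ℝ) (i : ℕ) : Set (J → ℝ) :=
  {x | (argmax J h i x).Nontrivial}

/-- The closed region `g̃ (i, j̄)` of points at which the maximum is attained at `j̄`. -/
def sector (J : Finset ℕ) (h : ℕ → ℕ → ℝ) (i : ℕ) (j : J) : Set (J → ℝ) :=
  {x | j ∈ argmax J h i x}

/-- `H_i` is the locus where two of the regions `g̃ (i, j̄)` meet. -/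
theorem mem_tropicalHyperplane {J : Finset ℕ} {h : ℕ → ℕ → ℝ} {i : ℕ} {x : J → ℝ} :
    x ∈ tropicalHyperplane J h i ↔ ∃ j k, j ≠ k ∧ x ∈ sector J h i j ∩ sector J h i k :=
  ⟨fun ⟨j, hj, k, hk, hjk⟩ => ⟨j, k, hjk, hj, hk⟩, fun ⟨j, k, hjk, hj, hk⟩ => ⟨j, hj, k, hk, hjk⟩⟩

/-- The polyhedron `g (G)`: the intersection of the regions `g̃ (i, j̄)` for `(i, j̄) ∈ G` with the
hyperplane where the coordinate of `max J̄` vanishes. -/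
def polyhedron (J : Finset ℕ) (hJ : J.Nonempty) (h : ℕ → ℕ → ℝ) (G : Finset (ℕ × ℕ)) :
    Set (J → ℝ) :=
  {x | x ⟨J.max' hJ, J.max'_mem hJ⟩ = 0 ∧ ∀ i, ∀ j : J, (i, (j : ℕ)) ∈ G → x ∈ sector J h i j}

/-- The cells of the `(I, J̄)`-associahedron: the bounded ones among the cells that the tropical
hyperplanes `H_i`, `i ∈ I`, induce, which are the nonempty intersections of regions containing
at least one region of each `H_i`. -/
def associahedronCells (I J : Finset ℕ) (hJ : J.Nonempty) (h : ℕ → ℕ → ℝ) : Set (Set (J → ℝ)) :=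
  {C | C.Nonempty ∧ Bornology.IsBounded C ∧
    ∃ G ⊆ I ×ˢ J, (∀ i ∈ I, ∃ j, (i, j) ∈ G) ∧ C = polyhedron J hJ h G}

end TamariAssoc

/-! Every complex involved is a flag complex: its faces are the finite sets of admissible vertices
with no conflicting pair. An isomorphism therefore amounts to a bijection of vertices respecting
conflicts (`IsFlag.isomorphic`), and links, deletions and joins only change the vertex set and the
conflict relation.

The arcs of a forest `F`, together with the root arc, form a laminar family, since overlapping
non-crossing intervals are nested. An arc compatible with `F` thus belongs to the region of the
shortest member strictly containing it (`exists_inRegion`). In particular an arc of `F` moves to the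
next larger member; only the root stays in its own region. Arcs in different regions neither
coincide nor cross (`eq_of_inRegion`), and this is the join decomposition of the link. If `F` is
covering, its arcs match all nodes of a region, except possibly the two extreme ones, into adjacent
pairs. These pairs and the outer arc become the edges of a polygon and the remaining arcs its inner
diagonals (`exists_bijOn_innerDiagonals`).

For the geometry, attach to a point the set of arcs at which the maxima are attained. The
non-crossing inequality makes this set a forest (`isForest_activeArcs`), and every forest covering
all nodes occurs, by an inductive construction of potentials (`exists_potential`). A bounded cell
comes from a covering forest `G`, because a missing root arc or an isolated column gives a direction
of recession. Faces of a polyhedron correspond to sets of tight constraints, so the faces of the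
cell correspond, in reverse order, to the forests containing `G`, that is, to the faces of its link.
The combinatorial decomposition then turns the join into a product. The polytopes serving as factors
are themselves cells, for the heights `i * j`. -/

namespace TamariAssoc

/-! ### Flag complexes, their joins and links, and face posets -/

section Flag

variable {V W : Type*}

theorem isFace_ofFaces {P : Finset V → Prop} (hP : ∀ s t, t ⊆ s → P s → P t) (h0 : P ∅)
    (s : Finset V) : IsFace (ofFaces P hP) s ↔ P s := by
  constructor
  · rintro (rfl | h)
    · exact h0
    · exact h.2
  · intro h
    rcases s.eq_empty_or_nonempty with rfl | hs
    · exact Or.inl rfl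
    · exact Or.inr ⟨hs, h⟩

theorem mem_faces_iff {K : PreAbstractSimplicialComplex V} {s : Finset V} :
    s ∈ K.faces ↔ s.Nonempty ∧ IsFace K s := by
  constructor
  · exact fun h => ⟨(K.isRelLowerSet_faces h).1, Or.inr h⟩
  · rintro ⟨hs, rfl | h⟩
    · exact absurd hs Finset.not_nonempty_empty
    · exact h

/-- The faces of `K` are the finite sets of elements satisfying `P` no two of which are
related by `R`. -/
def IsFlag (K : PreAbstractSimplicialComplex V) (P : V → Prop) (R : V → V → Prop) : Prop :=
  ∀ s, IsFace K s ↔ (∀ a ∈ s, P a) ∧ ∀ a ∈ s, ∀ b ∈ s, ¬ R a b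

theorem IsFlag.congr {K : PreAbstractSimplicialComplex V} {P Q : V → Prop} {R : V → V → Prop}
    (hK : IsFlag K P R) (h : ∀ a, P a ↔ Q a) : IsFlag K Q R := by
  have : P = Q := funext fun a => propext (h a)
  exact this ▸ hK

theorem IsFlag.singleton_mem {K : PreAbstractSimplicialComplex V} {P : V → Prop}
    {R : V → V → Prop} (hK : IsFlag K P R) (hR : ∀ a, ¬ R a a) (v : V) :
    {v} ∈ K.faces ↔ P v := by
  rw [mem_faces_iff, hK]
  simp [hR]

/-- Pairwise conflicts determine all faces, so only vertices and pairs need comparison.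
Irreflexivity guarantees that each admissible element really is a vertex. -/
theorem IsFlag.isomorphic {K : PreAbstractSimplicialComplex V}
    {L : PreAbstractSimplicialComplex W} {P : V → Prop} {R : V → V → Prop} {Q : W → Prop}
    {S : W → W → Prop} (hK : IsFlag K P R) (hL : IsFlag L Q S) (hR : ∀ a, ¬ R a a)
    (hS : ∀ a, ¬ S a a) (φ : V → W) (hφ : Set.BijOn φ {a | P a} {b | Q b})
    (hRS : ∀ a b, P a → P b → (R a b ↔ S (φ a) (φ b))) : Isomorphic K L := by
  have hv := hK.singleton_mem hR
  refine ⟨(Equiv.subtypeEquivRight hv).trans ((Set.BijOn.equiv φ hφ).trans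
    (Equiv.subtypeEquivRight (hL.singleton_mem hS)).symm), fun s => ?_⟩
  rw [mem_faces_iff, mem_faces_iff, hK, hL]
  simp only [Finset.map_nonempty]
  refine and_congr_right fun _ => and_congr ?_ ?_
  · constructor
    · intro h a ha
      simp only [Finset.mem_map] at ha
      obtain ⟨_, ⟨b, _, rfl⟩, rfl⟩ := ha
      exact hφ.mapsTo ((hv _).1 b.2)
    · intro h a ha
      simp only [Finset.mem_map] at ha
      obtain ⟨b, _, rfl⟩ := ha
      exact (hv _).1 b.2
  · simp only [Finset.mem_map]
    constructor
    · rintro h _ ⟨_, ⟨a, ha, rfl⟩, rfl⟩ _ ⟨_, ⟨b, hb, rfl⟩, rfl⟩ hab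
      exact h _ ⟨a, ha, rfl⟩ _ ⟨b, hb, rfl⟩
        ((hRS _ _ ((hv _).1 a.2) ((hv _).1 b.2)).2 hab)
    · rintro h _ ⟨a, ha, rfl⟩ _ ⟨b, hb, rfl⟩ hab
      exact h _ ⟨_, ⟨a, ha, rfl⟩, rfl⟩ _ ⟨_, ⟨b, hb, rfl⟩, rfl⟩
        ((hRS _ _ ((hv _).1 a.2) ((hv _).1 b.2)).1 hab)

theorem Isomorphic.symm {K : PreAbstractSimplicialComplex V}
    {L : PreAbstractSimplicialComplex W} (h : Isomorphic K L) : Isomorphic L K := by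
  obtain ⟨e, he⟩ := h
  refine ⟨e.symm, fun s => ?_⟩
  have := he (s.map e.symm.toEmbedding)
  rw [this, Finset.map_map (f := e.symm.toEmbedding)]
  simp

theorem isFlag_ofFaces {P : V → Prop} {R : V → V → Prop} {T : Finset V → Prop}
    (hT : ∀ s t, t ⊆ s → T s → T t)
    (h : ∀ s, T s ↔ (∀ a ∈ s, P a) ∧ ∀ a ∈ s, ∀ b ∈ s, ¬ R a b) :
    IsFlag (ofFaces T hT) P R := fun s => by
  rw [isFace_ofFaces hT ((h ∅).2 (by simp)), h]

theorem isFlag_fullSimplex (F : Finset V) :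
    IsFlag (fullSimplex F) (fun a => a ∈ F) fun _ _ => False :=
  isFlag_ofFaces _ fun s => by simp [Finset.subset_iff]

theorem IsFlag.deletion {K : PreAbstractSimplicialComplex V} {P : V → Prop}
    {R : V → V → Prop} (hK : IsFlag K P R) (v : V) :
    IsFlag (deletion K v) (fun a => P a ∧ a ≠ v) R :=
  isFlag_ofFaces _ fun s => by
    rw [hK]
    constructor
    · rintro ⟨⟨h1, h2⟩, h3⟩
      exact ⟨fun a ha => ⟨h1 a ha, fun h => h3 (h ▸ ha)⟩, h2⟩
    · rintro ⟨h1, h2⟩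
      exact ⟨⟨fun a ha => (h1 a ha).1, h2⟩, fun h => (h1 v h).2 rfl⟩

theorem isFace_link_iff [DecidableEq V] {K : PreAbstractSimplicialComplex V}
    {F : Finset V} (hF : IsFace K F) (s : Finset V) :
    IsFace (link K F) s ↔ Disjoint s F ∧ IsFace K (s ∪ F) := by
  rw [link, isFace_ofFaces _ ⟨F, hF, subset_rfl, by simp⟩]
  constructor
  · rintro ⟨G, hG, hFG, rfl⟩
    rw [Finset.sdiff_union_of_subset hFG]
    exact ⟨Finset.sdiff_disjoint, hG⟩
  · rintro ⟨hd, h⟩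
    exact ⟨s ∪ F, h, Finset.subset_union_right, by
      rw [Finset.union_sdiff_right, Finset.sdiff_eq_self_of_disjoint hd]⟩

/-- Adding `F` to a set creates only conflicts between a new element and one of `F`. These are
excluded one vertex at a time, so flagness survives. -/
theorem IsFlag.link [DecidableEq V] {K : PreAbstractSimplicialComplex V} {P : V → Prop}
    {R : V → V → Prop} (hK : IsFlag K P R) {F : Finset V} (hF : IsFace K F) :
    IsFlag (link K F) (fun a => P a ∧ a ∉ F ∧ ∀ b ∈ F, ¬ R a b ∧ ¬ R b a) R := fun s => by
  rw [isFace_link_iff hF, hK, Finset.disjoint_left]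
  obtain ⟨h1, h2⟩ := (hK F).1 hF
  simp only [Finset.mem_union]
  constructor
  · rintro ⟨h3, h4, h5⟩
    exact ⟨fun a ha => ⟨h4 a (Or.inl ha), h3 ha, fun b hb =>
      ⟨h5 a (Or.inl ha) b (Or.inr hb), h5 b (Or.inr hb) a (Or.inl ha)⟩⟩,
      fun a ha b hb => h5 a (Or.inl ha) b (Or.inl hb)⟩
  · rintro ⟨h3, h4⟩
    refine ⟨fun a ha => (h3 a ha).2.1, fun a ha => ha.elim (fun h => (h3 a h).1) (h1 a), ?_⟩
    rintro a (ha | ha) b (hb | hb)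
    · exact h4 a ha b hb
    · exact ((h3 a ha).2.2 b hb).1
    · exact ((h3 b hb).2.2 a ha).2
    · exact h2 a ha b hb

theorem IsFlag.join {K : PreAbstractSimplicialComplex V} {L : PreAbstractSimplicialComplex W}
    {P : V → Prop} {R : V → V → Prop} {Q : W → Prop} {S : W → W → Prop} (hK : IsFlag K P R)
    (hL : IsFlag L Q S) : IsFlag (join K L) (Sum.elim P Q) (Sum.LiftRel R S) :=
  isFlag_ofFaces _ fun s => by
    rw [hK, hL]
    simp [Sum.forall]
    tauto

/-- The disjoint union of a family of relations. -/
def SigmaRel {ι : Type*} {X : ι → Type*} (R : ∀ k, X k → X k → Prop) (x y : Σ k, X k) : Prop :=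
  ∃ k a b, x = ⟨k, a⟩ ∧ y = ⟨k, b⟩ ∧ R k a b

theorem sigmaRel_mk {ι : Type*} {X : ι → Type*} {R : ∀ k, X k → X k → Prop} {k : ι}
    {a b : X k} : SigmaRel R ⟨k, a⟩ ⟨k, b⟩ ↔ R k a b := by
  constructor
  · rintro ⟨l, a', b', h1, h2, h3⟩
    cases h1
    cases h2
    exact h3
  · exact fun h => ⟨k, a, b, rfl, rfl, h⟩

theorem mem_slice {ι : Type*} {X : ι → Type*} {s : Finset (Σ k, X k)} {k : ι} {a : X k} :
    a ∈ slice s k ↔ (⟨k, a⟩ : Σ k, X k) ∈ s := by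
  simp [slice]

theorem IsFlag.iJoin {ι : Type*} {X : ι → Type*} {K : ∀ k, PreAbstractSimplicialComplex (X k)}
    {P : ∀ k, X k → Prop} {R : ∀ k, X k → X k → Prop} (hK : ∀ k, IsFlag (K k) (P k) (R k)) :
    IsFlag (iJoin K) (fun x => P x.1 x.2) (SigmaRel R) :=
  isFlag_ofFaces _ fun s => by
    simp only [hK _ _, mem_slice]
    constructor
    · refine fun h => ⟨fun x hx => (h x.1).1 x.2 hx, ?_⟩
      rintro _ hx _ hy ⟨k, a, b, rfl, rfl, hab⟩
      exact (h k).2 a hx b hy hab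
    · exact fun h k => ⟨fun a ha => h.1 _ ha, fun a ha b hb hab =>
        h.2 _ ha _ hb (sigmaRel_mk.2 hab)⟩

theorem isFace_iJoin {ι : Type*} {X : ι → Type*} {K : ∀ k, PreAbstractSimplicialComplex (X k)}
    (s : Finset (Σ k, X k)) : IsFace (iJoin K) s ↔ ∀ k, IsFace (K k) (slice s k) :=
  isFace_ofFaces _ (fun k => Or.inl (by ext; simp [mem_slice])) s

/-- The faces of a join of finitely many complexes are the families of faces. -/
noncomputable def facePosetIJoin {ι : Type*} [Fintype ι] {X : ι → Type*}
    (K : ∀ k, PreAbstractSimplicialComplex (X k)) :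
    FacePoset (iJoin K) ≃o ∀ k, FacePoset (K k) where
  toFun s k := ⟨slice s.1 k, (isFace_iJoin _).1 s.2 k⟩
  invFun t := ⟨Finset.univ.sigma fun k => (t k).1, (isFace_iJoin _).2 fun k => by
    convert (t k).2
    ext
    simp [mem_slice]⟩
  left_inv s := by
    ext
    simp [mem_slice]
  right_inv t := by
    ext
    simp [mem_slice]
  map_rel_iff' {s t} := by
    simp only [Equiv.coe_fn_mk, Pi.le_def,
      Finset.subset_iff, mem_slice, ← Subtype.coe_le_coe]
    exact ⟨fun h x hx => h x.1 hx, fun h k a ha => h ha⟩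

theorem IsFace.singleton_mem {K : PreAbstractSimplicialComplex V} {s : Finset V}
    (hs : IsFace K s) {a : V} (ha : a ∈ s) : {a} ∈ K.faces :=
  mem_faces_iff.2 ⟨by simp, hs.mono (by simpa)⟩

theorem isFace_map_iff {K : PreAbstractSimplicialComplex V}
    {L : PreAbstractSimplicialComplex W} (e : Vertices K ≃ Vertices L)
    (he : ∀ s : Finset (Vertices K), s.map (Function.Embedding.subtype _) ∈ K.faces ↔
      (s.map e.toEmbedding).map (Function.Embedding.subtype _) ∈ L.faces)
    (s : Finset (Vertices K)) : IsFace K (s.map (Function.Embedding.subtype _)) ↔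
      IsFace L ((s.map e.toEmbedding).map (Function.Embedding.subtype _)) := by
  simp [IsFace, he]

theorem IsFace.exists_map {K : PreAbstractSimplicialComplex V} {s : Finset V}
    (hs : IsFace K s) : ∃ t : Finset (Vertices K), t.map (Function.Embedding.subtype _) = s := by
  classical
  exact ⟨s.subtype _, Finset.subtype_map_of_mem fun a ha => hs.singleton_mem ha⟩

/-- The faces of a complex, as sets of vertices. -/
theorem nonempty_facePoset_orderIso (K : PreAbstractSimplicialComplex V) :
    Nonempty ({s : Finset (Vertices K) // IsFace K (s.map (Function.Embedding.subtype _))} ≃o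
      FacePoset K) := by
  let f : {s : Finset (Vertices K) // IsFace K (s.map (Function.Embedding.subtype _))} ↪o
      FacePoset K :=
    { toFun := fun s => ⟨_, s.2⟩
      inj' := fun s t h => Subtype.ext (Finset.map_injective _ (Subtype.ext_iff.1 h))
      map_rel_iff' := by
        intro s t
        exact Finset.map_subset_map }
  refine ⟨RelIso.ofSurjective f fun s => ?_⟩
  obtain ⟨t, ht⟩ := s.2.exists_map
  exact ⟨⟨t, ht ▸ s.2⟩, Subtype.ext ht⟩

/-- Bridge from the combinatorial isomorphisms to polytopes, which are compared only through face
posets. -/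
theorem Isomorphic.nonempty_orderIso {K : PreAbstractSimplicialComplex V}
    {L : PreAbstractSimplicialComplex W} (h : Isomorphic K L) :
    Nonempty (FacePoset K ≃o FacePoset L) := by
  obtain ⟨e, he⟩ := h
  obtain ⟨f⟩ := nonempty_facePoset_orderIso K
  obtain ⟨g⟩ := nonempty_facePoset_orderIso L
  let m : {s : Finset (Vertices K) // IsFace K (s.map (Function.Embedding.subtype _))} ≃o
      {s : Finset (Vertices L) // IsFace L (s.map (Function.Embedding.subtype _))} :=
    { toEquiv := e.finsetCongr.subtypeEquiv fun s => isFace_map_iff e he s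
      map_rel_iff' := by
        intro s t
        exact Finset.map_subset_map }
  exact ⟨f.symm.trans (m.trans g)⟩

end Flag

/-! ### Laminar families of arcs and the regions they cut out -/

section Regions

theorem crossing_iff {a b : ℕ × ℕ} : Crossing a b ↔ a.1 < b.1 ∧ b.1 ≤ a.2 ∧ a.2 < b.2 := by
  simp only [Crossing, bl_lt_bl, bl_lt_wh, wh_lt_wh]

theorem not_crossing_self (a : ℕ × ℕ) : ¬ Crossing a a := fun h => lt_irrefl _ h.1

theorem wh_lt_bl {i k : ℕ} : wh i < bl k ↔ i < k := by
  rw [← not_le, ← not_le, not_iff_not, le_iff_lt_or_eq, bl_lt_wh]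
  simp [bl, wh]

theorem bl_mem_openInterval {x : ℕ} {a : ℕ × ℕ} :
    bl x ∈ openInterval a ↔ a.1 < x ∧ x ≤ a.2 := by
  simp only [openInterval, Set.mem_Ioo, bl_lt_bl, bl_lt_wh]

theorem wh_mem_openInterval {x : ℕ} {a : ℕ × ℕ} :
    wh x ∈ openInterval a ↔ a.1 ≤ x ∧ x < a.2 := by
  simp only [openInterval, Set.mem_Ioo, bl_lt_wh, wh_lt_wh]

theorem bl_mem_closedInterval {x : ℕ} {a : ℕ × ℕ} :
    bl x ∈ closedInterval a ↔ a.1 ≤ x ∧ x ≤ a.2 := by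
  simp only [closedInterval, Set.mem_Icc, ← not_lt, bl_lt_bl, wh_lt_bl]

theorem wh_mem_closedInterval {x : ℕ} {a : ℕ × ℕ} :
    wh x ∈ closedInterval a ↔ a.1 ≤ x ∧ x ≤ a.2 := by
  simp only [closedInterval, Set.mem_Icc, ← not_lt, wh_lt_wh, wh_lt_bl]

/-- The interval of `b` is contained in the interval of `a`. -/
def Inside (b a : ℕ × ℕ) : Prop := a.1 ≤ b.1 ∧ b.2 ≤ a.2

theorem closedInterval_subset_iff {a b : ℕ × ℕ} (hb : b.1 ≤ b.2) :
    closedInterval b ⊆ closedInterval a ↔ Inside b a := by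
  rw [closedInterval, closedInterval, Set.Icc_subset_Icc_iff (bl_lt_wh.2 hb).le, Inside,
    ← not_lt, ← not_lt, bl_lt_bl, wh_lt_wh, not_lt, not_lt]

theorem Inside.antisymm {a b : ℕ × ℕ} (h : Inside a b) (h' : Inside b a) : a = b :=
  Prod.ext (le_antisymm h'.1 h.1) (le_antisymm h.2 h'.2)

theorem closedInterval_ssubset_iff {a b : ℕ × ℕ} (ha : a.1 ≤ a.2) (hb : b.1 ≤ b.2) :
    closedInterval b ⊂ closedInterval a ↔ Inside b a ∧ b ≠ a := by
  rw [ssubset_iff_subset_not_subset, closedInterval_subset_iff hb, closedInterval_subset_iff ha]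
  refine and_congr_right fun h => not_iff_not.2 ⟨fun h' => h.antisymm h', ?_⟩
  rintro rfl
  exact h

/-- The end points of the arc `c` lie in the region of the arc `a` with respect to `F`. -/
def InRegion (F : Finset (ℕ × ℕ)) (a c : ℕ × ℕ) : Prop :=
  Inside c a ∧ ∀ b ∈ F, Inside b a → b ≠ a →
    ¬ (b.1 < c.1 ∧ c.1 ≤ b.2) ∧ ¬ (b.1 ≤ c.2 ∧ c.2 < b.2)

/-- `c` is an arc between nodes of `I` and `J`. -/
def IsArc (I J : Finset ℕ) (c : ℕ × ℕ) : Prop := c ∈ I ×ˢ J ∧ c.1 ≤ c.2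

theorem isFlag_tamariComplex (I J : Finset ℕ) :
    IsFlag (tamariComplex I J) (IsArc I J) Crossing :=
  isFlag_ofFaces _ fun s => by
    constructor
    · exact fun h => ⟨fun a ha => ⟨h.subset ha, bl_lt_wh.1 (h.increasing a ha)⟩, h.nonCrossing⟩
    · exact fun h => ⟨fun a ha => (h.1 a ha).1, fun a ha => bl_lt_wh.2 (h.1 a ha).2, h.2⟩

theorem IsForest.isArc {I J : Finset ℕ} {F : Finset (ℕ × ℕ)} (hF : IsForest I J F)
    {a : ℕ × ℕ} (ha : a ∈ F) : IsArc I J a :=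
  ⟨hF.subset ha, bl_lt_wh.1 (hF.increasing a ha)⟩

theorem isFace_tamariComplex {I J : Finset ℕ} (F : Finset (ℕ × ℕ)) :
    IsFace (tamariComplex I J) F ↔ IsForest I J F :=
  isFace_ofFaces _ ⟨by simp, by simp, by simp⟩ F

theorem isFlag_tamariOn (I J : Finset ℕ) (S : Set Node) :
    IsFlag (tamariOn I J S) (fun c => IsArc I J c ∧ bl c.1 ∈ S ∧ wh c.2 ∈ S) Crossing := by
  refine (isFlag_tamariComplex _ _).congr fun c => ?_
  simp only [IsArc, Finset.mem_product, Finset.mem_filter]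
  tauto

theorem isFlag_tamariOn_region {I J : Finset ℕ} {F : Finset (ℕ × ℕ)} (hF : IsForest I J F)
    {a : ℕ × ℕ} (ha : a.1 ≤ a.2) : IsFlag (tamariOn I J (region F a))
      (fun c => IsArc I J c ∧ InRegion F a c) Crossing := by
  refine (isFlag_tamariOn I J _).congr fun c => and_congr_right fun hc => ?_
  simp only [region, Set.mem_sdiff, Set.mem_ofPred_eq, bl_mem_closedInterval,
    wh_mem_closedInterval, bl_mem_openInterval, wh_mem_openInterval, not_exists, not_and]
  have hc := hc.2
  constructor
  · rintro ⟨⟨h1, h2⟩, h3, h4⟩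
    refine ⟨⟨h1.1, h3.2⟩, fun b hb hba hne => ?_⟩
    have hs := (closedInterval_ssubset_iff ha (hF.isArc hb).2).2 ⟨hba, hne⟩
    exact ⟨fun h => h2 b hb hs h.1 h.2, fun h => h4 b hb hs h.1 h.2⟩
  · rintro ⟨⟨h1, h2⟩, h3⟩
    refine ⟨⟨⟨h1, by omega⟩, fun b hb hs h h' => ?_⟩, ⟨by omega, h2⟩, fun b hb hs h h' => ?_⟩
    · obtain ⟨hba, hne⟩ := (closedInterval_ssubset_iff ha (hF.isArc hb).2).1 hs
      exact (h3 b hb hba hne).1 ⟨h, h'⟩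
    · obtain ⟨hba, hne⟩ := (closedInterval_ssubset_iff ha (hF.isArc hb).2).1 hs
      exact (h3 b hb hba hne).2 ⟨h, h'⟩

/-- `c` crosses no arc of `F`. -/
def Compatible (F : Finset (ℕ × ℕ)) (c : ℕ × ℕ) : Prop :=
  ∀ b ∈ F, ¬ Crossing c b ∧ ¬ Crossing b c

theorem IsForest.compatible {I J : Finset ℕ} {F : Finset (ℕ × ℕ)} (hF : IsForest I J F)
    {a : ℕ × ℕ} (ha : a ∈ F) : Compatible F a :=
  fun b hb => ⟨hF.nonCrossing a ha b hb, hF.nonCrossing b hb a ha⟩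

variable {I J : Finset ℕ} {F : Finset (ℕ × ℕ)} {r : ℕ × ℕ}

/-- Take the shortest arc of `F` or root that contains `c`, strictly unless it is the root. An arc
of `F` inside it that hid an end of `c` would, by compatibility, contain `c` strictly and be
shorter. The last alternative matches the deletion of `a` from its own region, which is not made for
the root. -/
theorem exists_inRegion (hF : IsForest I J F) (hr : ∀ c ∈ I ×ˢ J, Inside c r) {c : ℕ × ℕ}
    (hc : IsArc I J c) (hcF : Compatible F c) :
    ∃ a, (a ∈ F ∨ a = r) ∧ InRegion F a c ∧ (c ≠ a ∨ a = r) := by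
  classical
  obtain ⟨a, ha, hmin⟩ := Finset.exists_min_image
    ({a ∈ insert r F | Inside c a ∧ (c ≠ a ∨ a = r)}) (fun a => a.2 - a.1)
    ⟨r, by simpa using hr c hc.1⟩
  simp only [Finset.mem_filter, Finset.mem_insert] at ha hmin
  refine ⟨a, ha.1.symm, ⟨ha.2.1, fun b hb hba hne => ?_⟩, ha.2.2⟩
  have hcb := hcF b hb
  have hb' := (hF.isArc hb).2
  have hc' := hc.2
  rw [crossing_iff, crossing_iff] at hcb
  have key : ¬ (Inside c b ∧ c ≠ b) := fun h => by
    have h1 := hmin b ⟨Or.inr hb, h.1, Or.inl h.2⟩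
    have h2 : ¬ (a.1 = b.1 ∧ a.2 = b.2) := fun h => hne (Prod.ext h.1.symm h.2.symm)
    simp only [Inside] at hba h
    omega
  have key' : Inside c b → c.1 = b.1 ∧ c.2 = b.2 := fun h =>
    Prod.ext_iff.1 (not_not.1 fun h' => key ⟨h, h'⟩)
  simp only [Inside] at key' hba
  omega

/-- Laminarity: a partial overlap of two intervals is exactly a crossing. -/
theorem inside_or_inside_of_overlap (hF : IsForest I J F) (hr : ∀ c ∈ I ×ˢ J, Inside c r)
    {a a' : ℕ × ℕ} (ha : a ∈ F ∨ a = r) (ha' : a' ∈ F ∨ a' = r) (h : a.1 ≤ a'.2)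
    (h' : a'.1 ≤ a.2) : Inside a a' ∨ Inside a' a := by
  rcases ha with ha | rfl
  · rcases ha' with ha' | rfl
    · have h1 := hF.nonCrossing a ha a' ha'
      have h2 := hF.nonCrossing a' ha' a ha
      rw [crossing_iff] at h1 h2
      simp only [Inside]
      omega
    · exact Or.inl (hr a (hF.subset ha))
  · rcases ha' with ha' | rfl
    · exact Or.inr (hr a' (hF.subset ha'))
    · exact Or.inl ⟨le_rfl, le_rfl⟩

/-- By laminarity one of `a`, `a'` contains the other. If `a` were strictly inside `a'`, the ends of
`c'` would avoid the open interval of `a`, whereas `c` lies in the closed one. Then the two cannot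
cross, and `c = c'` would force `c = a`, which is excluded. -/
theorem eq_of_inRegion (hF : IsForest I J F) (hr : ∀ c ∈ I ×ˢ J, Inside c r) {c c' : ℕ × ℕ}
    (hc : IsArc I J c) (hc' : IsArc I J c') {a a' : ℕ × ℕ} (ha : a ∈ F ∨ a = r)
    (ha' : a' ∈ F ∨ a' = r) (h : InRegion F a c) (h' : InRegion F a' c') (hca : c ≠ a ∨ a = r)
    (hca' : c' ≠ a' ∨ a' = r) (hcc : Crossing c c' ∨ Crossing c' c ∨ c = c') : a = a' := by
  have main : ∀ {c c' a a' : ℕ × ℕ}, IsArc I J c → IsArc I J c' → (a ∈ F ∨ a = r) →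
      InRegion F a c → InRegion F a' c' → (c ≠ a ∨ a = r) → (a' ∈ F ∨ a' = r) →
      (Crossing c c' ∨ Crossing c' c ∨ c = c') → Inside a a' → a = a' := by
    intro c c' a a' hc hc' ha h h' hca ha' hcc hs
    by_contra hne
    have haF : a ∈ F := by
      rcases ha with ha | rfl
      · exact ha
      · rcases ha' with ha' | rfl
        · exact absurd (hs.antisymm (hr a' (hF.subset ha'))) hne
        · exact absurd rfl hne
    have hcr : c ≠ a := hca.resolve_right fun h' => by
      subst h'
      rcases ha' with ha' | rfl
      · exact hne (hs.antisymm (hr a' (hF.subset ha')))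
      · exact hne rfl
    have h1 := h'.2 a haF hs hne
    have h2 := h.1
    have h3 := hc.2
    have h4 := hc'.2
    have h5 : ¬ (c.1 = a.1 ∧ c.2 = a.2) := fun h => hcr (Prod.ext h.1 h.2)
    rw [crossing_iff, crossing_iff, Prod.ext_iff] at hcc
    simp only [Inside] at h2
    omega
  have h1 := hc.2
  have h2 := hc'.2
  have h3 := h.1
  have h4 := h'.1
  have hcc' := hcc
  rw [crossing_iff, crossing_iff, Prod.ext_iff] at hcc'
  simp only [Inside] at h3 h4
  rcases inside_or_inside_of_overlap hF hr ha ha' (by omega) (by omega) with hs | hs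
  · exact main hc hc' ha h h' hca ha' hcc hs
  · exact (main hc' hc ha' h' h hca' ha
      (hcc.elim (fun h => Or.inr (Or.inl h))
        fun h => h.elim Or.inl fun h => Or.inr (Or.inr h.symm)) hs).symm

/-- An arc `b` of `F` is properly inside `a`, contains `a`, or is disjoint from it. In the first
case the ends of `c` avoid the interior of `b`, in the second `b` contains `c`, in the third they do
not meet. -/
theorem compatible_of_inRegion (hF : IsForest I J F) (hr : ∀ c ∈ I ×ˢ J, Inside c r)
    {c : ℕ × ℕ} (hc : IsArc I J c) {a : ℕ × ℕ} (ha : a ∈ F ∨ a = r) (h : InRegion F a c) :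
    Compatible F c := by
  intro b hb
  have h1 := h.1
  have h2 := hc.2
  have h3 := (hF.isArc hb).2
  by_cases hba : Inside b a
  · by_cases hne : b = a
    · subst hne
      rw [crossing_iff, crossing_iff]
      simp only [Inside] at h1
      omega
    · have h4 := h.2 b hb hba hne
      rw [crossing_iff, crossing_iff]
      omega
  · have h5 : b.1 ≤ a.2 → a.1 ≤ b.2 → Inside b a ∨ Inside a b := fun h h' =>
      inside_or_inside_of_overlap hF hr (Or.inl hb) ha h h'
    rw [crossing_iff, crossing_iff]
    simp only [Inside] at h1 h5 hba
    omega

end Regions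

/-! ### Join decompositions of links -/

section Links

variable {I J : Finset ℕ} {F : Finset (ℕ × ℕ)} {r : ℕ × ℕ}

theorem isFlag_link_tamariComplex (hF : IsForest I J F) : IsFlag (link (tamariComplex I J) F)
    (fun c => IsArc I J c ∧ c ∉ F ∧ Compatible F c) Crossing :=
  (isFlag_tamariComplex I J).link ((isFace_tamariComplex F).2 hF)

/-- The decomposition of the link of a forest by the regions of its arcs. -/
theorem isomorphic_link_join_fullSimplex (hF : IsForest I J F) (hr : r.1 ≤ r.2)
    (hr' : ∀ c ∈ I ×ˢ J, Inside c r) : Isomorphic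
      (join (link (tamariComplex I J) F) (fullSimplex F))
      (join (iJoin fun a : {a // a ∈ F ∧ a ≠ r} => deletion (tamariOn I J (region F a)) a)
        (tamariOn I J (region F r))) := by
  classical
  -- The vertices of link and simplex together are exactly the arcs compatible with `F`; `τ` sorts
  -- an arc into the summand it comes from.
  let τ : ℕ × ℕ → (ℕ × ℕ) ⊕ (ℕ × ℕ) := fun c => if c ∈ F then Sum.inr c else Sum.inl c
  have τmem : ∀ {c}, c ∈ F → τ c = Sum.inr c := fun h => if_pos h
  have τnot : ∀ {c}, c ∉ F → τ c = Sum.inl c := fun h => if_neg h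
  have τinj : ∀ {c c'}, τ c = τ c' → c = c' := by
    intro c c' h
    by_cases hc : c ∈ F <;> by_cases hc' : c' ∈ F <;>
      simp_all [τ]
  have hK := (isFlag_link_tamariComplex hF).join (isFlag_fullSimplex F)
  have hL := (IsFlag.iJoin fun a : {a // a ∈ F ∧ a ≠ r} =>
    (isFlag_tamariOn_region hF (hF.isArc a.2.1).2).deletion a.1).join
      (isFlag_tamariOn_region (a := r) hF hr)
  have τP : ∀ {c}, IsArc I J c → Compatible F c →
      Sum.elim (fun c => IsArc I J c ∧ c ∉ F ∧ Compatible F c) (fun c => c ∈ F) (τ c) := by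
    intro c hc hcF
    by_cases h : c ∈ F
    · rw [τmem h]
      exact h
    · rw [τnot h]
      exact ⟨hc, h, hcF⟩
  have τR : ∀ {c c'}, Compatible F c → Compatible F c' →
      (Sum.LiftRel Crossing (fun _ _ => False) (τ c) (τ c') ↔ Crossing c c') := by
    intro c c' hc hc'
    by_cases h : c ∈ F
    · have := (hc' c h).2
      by_cases h' : c' ∈ F <;> simp [τmem, τnot, h, h', this]
    · by_cases h' : c' ∈ F
      · have := (hc c' h').1
        simp [τmem, τnot, h, h', this]
      · simp [τnot, h, h']
  refine Isomorphic.symm (hL.isomorphic hK ?_ ?_ (Sum.elim (fun x => τ x.2) τ) ⟨?_, ?_, ?_⟩ ?_)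
  · rintro (⟨a, c⟩ | c) h
    · exact not_crossing_self _ (sigmaRel_mk.1 (Sum.liftRel_inl_inl.1 h))
    · exact not_crossing_self _ (Sum.liftRel_inr_inr.1 h)
  · rintro (c | c) h
    · exact not_crossing_self _ (Sum.liftRel_inl_inl.1 h)
    · exact Sum.liftRel_inr_inr.1 h
  · rintro (⟨a, c⟩ | c) h
    · exact τP h.1.1 (compatible_of_inRegion hF hr' h.1.1 (Or.inl a.2.1) h.1.2)
    · exact τP h.1 (compatible_of_inRegion hF hr' h.1 (Or.inr rfl) h.2)
  · rintro (⟨⟨a, ha⟩, c⟩ | c) h (⟨⟨a', ha'⟩, c'⟩ | c') h' hcc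
    · obtain rfl : c = c' := τinj hcc
      obtain rfl : a = a' := eq_of_inRegion hF hr' h.1.1 h'.1.1 (Or.inl ha.1) (Or.inl ha'.1) h.1.2
        h'.1.2 (Or.inl h.2) (Or.inl h'.2) (Or.inr (Or.inr rfl))
      rfl
    · obtain rfl : c = c' := τinj hcc
      exact absurd (eq_of_inRegion hF hr' h.1.1 h'.1 (Or.inl ha.1) (Or.inr rfl) h.1.2
        h'.2 (Or.inl h.2) (Or.inr rfl) (Or.inr (Or.inr rfl))) ha.2
    · obtain rfl : c = c' := τinj hcc
      exact absurd (eq_of_inRegion hF hr' h.1 h'.1.1 (Or.inr rfl) (Or.inl ha'.1) h.2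
        h'.1.2 (Or.inr rfl) (Or.inl h'.2) (Or.inr (Or.inr rfl))).symm ha'.2
    · obtain rfl : c = c' := τinj hcc
      rfl
  · have key : ∀ {c}, IsArc I J c → Compatible F c →
        ∃ x, Sum.elim (fun x : Σ _ : {a // a ∈ F ∧ a ≠ r}, ℕ × ℕ =>
          (IsArc I J x.2 ∧ InRegion F x.1 x.2) ∧ x.2 ≠ x.1)
          (fun c => IsArc I J c ∧ InRegion F r c) x ∧ Sum.elim (fun x => τ x.2) τ x = τ c := by
      intro c hc hcF
      obtain ⟨a, ha, h, hca⟩ := exists_inRegion hF hr' hc hcF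
      by_cases har : a = r
      · subst har
        exact ⟨Sum.inr c, ⟨hc, h⟩, rfl⟩
      · exact ⟨Sum.inl ⟨⟨a, ha.resolve_right har, har⟩, c⟩,
          ⟨⟨hc, h⟩, hca.resolve_right har⟩, rfl⟩
    rintro (c | c) hc
    · have hc : IsArc I J c ∧ c ∉ F ∧ Compatible F c := hc
      have := key hc.1 hc.2.2
      rwa [τnot hc.2.1] at this
    · have hc : c ∈ F := hc
      have := key (hF.isArc hc) (hF.compatible hc)
      rwa [τmem hc] at this
  · rintro (⟨⟨a, ha⟩, c⟩ | c) (⟨⟨a', ha'⟩, c'⟩ | c') h h'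
    · simp only [Sum.elim_inl] at h h' ⊢
      rw [τR (compatible_of_inRegion hF hr' h.1.1 (Or.inl ha.1) h.1.2)
        (compatible_of_inRegion hF hr' h'.1.1 (Or.inl ha'.1) h'.1.2), Sum.liftRel_inl_inl]
      constructor
      · rintro ⟨k, b, b', h1, h2, h3⟩
        cases h1
        cases h2
        exact h3
      · intro hcc
        obtain rfl : a = a' := eq_of_inRegion hF hr' h.1.1 h'.1.1 (Or.inl ha.1) (Or.inl ha'.1)
          h.1.2 h'.1.2 (Or.inl h.2) (Or.inl h'.2) (Or.inl hcc)
        exact sigmaRel_mk.2 hcc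
    · simp only [Sum.elim_inl, Sum.elim_inr] at h h' ⊢
      rw [τR (compatible_of_inRegion hF hr' h.1.1 (Or.inl ha.1) h.1.2)
        (compatible_of_inRegion hF hr' h'.1 (Or.inr rfl) h'.2)]
      refine ⟨fun h => by simp at h, fun hcc => ?_⟩
      exact absurd (eq_of_inRegion hF hr' h.1.1 h'.1 (Or.inl ha.1) (Or.inr rfl) h.1.2
        h'.2 (Or.inl h.2) (Or.inr rfl) (Or.inl hcc)) ha.2
    · simp only [Sum.elim_inl, Sum.elim_inr] at h h' ⊢
      rw [τR (compatible_of_inRegion hF hr' h.1 (Or.inr rfl) h.2)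
        (compatible_of_inRegion hF hr' h'.1.1 (Or.inl ha'.1) h'.1.2)]
      refine ⟨fun h => by simp at h, fun hcc => ?_⟩
      exact absurd (eq_of_inRegion hF hr' h.1 h'.1.1 (Or.inr rfl) (Or.inl ha'.1) h.2
        h'.1.2 (Or.inr rfl) (Or.inl h'.2) (Or.inl hcc)).symm ha'.2
    · simp only [Sum.elim_inr] at h h' ⊢
      rw [τR (compatible_of_inRegion hF hr' h.1 (Or.inr rfl) h.2)
        (compatible_of_inRegion hF hr' h'.1 (Or.inr rfl) h'.2), Sum.liftRel_inr_inr]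

/-- The decomposition of the link of an arc. -/
theorem isomorphic_link_singleton {a : ℕ × ℕ} (ha : IsArc I J a) : Isomorphic
    (link (tamariComplex I J) {a})
    (join (deletion (tamariOn I J (closedInterval a)) a)
      (deletion (tamariOn I J (openInterval a)ᶜ) a)) := by
  have hF : IsForest I J {a} :=
    ⟨by simpa using ha.1, by simpa [bl_lt_wh] using ha.2, by simpa using not_crossing_self a⟩
  have hK := isFlag_link_tamariComplex hF
  have hL := ((isFlag_tamariOn I J (closedInterval a)).deletion a).join
    ((isFlag_tamariOn I J (openInterval a)ᶜ).deletion a)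
  simp only [Set.mem_compl_iff, bl_mem_closedInterval, wh_mem_closedInterval,
    bl_mem_openInterval, wh_mem_openInterval] at hL
  have ha' := ha.2
  refine Isomorphic.symm (hL.isomorphic hK ?_ not_crossing_self (Sum.elim id id) ⟨?_, ?_, ?_⟩ ?_)
  · rintro (c | c) h
    · exact not_crossing_self _ (Sum.liftRel_inl_inl.1 h)
    · exact not_crossing_self _ (Sum.liftRel_inr_inr.1 h)
  · rintro (c | c) ⟨⟨h1, h2⟩, h3⟩ <;>
    · have h4 := h1.2
      refine ⟨h1, by simpa using h3, ?_⟩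
      simp only [Compatible, Finset.mem_singleton, forall_eq, crossing_iff, Sum.elim_inl,
        Sum.elim_inr, id]
      omega
  -- The two factors share no vertex: an arc inside `a` with both ends off the open interval of `a`
  -- must be `a`, which both deletions remove.
  · have aux : ∀ {c c' : ℕ × ℕ}, c = c' → c ≠ a → (a.1 ≤ c.1 ∧ c.1 ≤ a.2) ∧
        a.1 ≤ c.2 ∧ c.2 ≤ a.2 → ¬ (a.1 < c'.1 ∧ c'.1 ≤ a.2) ∧ ¬ (a.1 ≤ c'.2 ∧ c'.2 < a.2) →
        False := by
      rintro c _ rfl h1 h2 h3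
      exact h1 (Prod.ext (by omega) (by omega))
    rintro (c | c) ⟨⟨h1, h2⟩, h3⟩ (c' | c') ⟨⟨h1', h2'⟩, h3'⟩ hcc
    · exact congrArg _ hcc
    · exact (aux hcc h3 h2 h2').elim
    · exact (aux hcc.symm h3' h2' h2).elim
    · exact congrArg _ hcc
  · rintro c ⟨h1, h2, h3⟩
    have h4 := h1.2
    have h2 : c ≠ a := by simpa using h2
    simp only [Compatible, Finset.mem_singleton, forall_eq, crossing_iff] at h3
    by_cases hin : Inside c a
    · refine ⟨Sum.inl c, ⟨⟨h1, ?_⟩, h2⟩, rfl⟩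
      simp only [Inside] at hin
      omega
    · refine ⟨Sum.inr c, ⟨⟨h1, ?_⟩, h2⟩, rfl⟩
      simp only [Inside] at hin
      omega
  · rintro (c | c) (c' | c') ⟨⟨h1, h2⟩, h3⟩ ⟨⟨h1', h2'⟩, h3'⟩
    · simp
    · have h4 := h1.2
      have h4' := h1'.2
      simp only [Sum.elim_inl, Sum.elim_inr, id, Sum.not_liftRel_inl_inr, crossing_iff, false_iff]
      omega
    · have h4 := h1.2
      have h4' := h1'.2
      simp only [Sum.elim_inl, Sum.elim_inr, id, Sum.not_liftRel_inr_inl, crossing_iff, false_iff]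
      omega
    · simp

end Links

/-! ### Ranks of nodes as polygon vertices -/

section Counting

theorem card_filter_lt_injOn (X : Finset ℕ) :
    Set.InjOn (fun i => (X.filter (· < i)).card) X := by
  intro i hi i' hi' h
  by_contra hne
  wlog hlt : i < i' generalizing i i'
  · exact this hi' hi h.symm (Ne.symm hne) (by omega)
  have : (X.filter (· < i)) ⊂ (X.filter (· < i')) := by
    rw [Finset.ssubset_iff_of_subset
      (Finset.monotone_filter_right X fun k _ (hk : k < i) => (hk.trans hlt : k < i'))]
    exact ⟨i, by simpa using ⟨hi, hlt⟩, by simp⟩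
  exact (Finset.card_lt_card this).ne h

theorem card_filter_lt_lt_iff {X : Finset ℕ} {i i' : ℕ} (hi : i ∈ X) :
    (X.filter (· < i)).card < (X.filter (· < i')).card ↔ i < i' := by
  constructor
  · intro h
    by_contra hle
    refine h.not_ge (Finset.card_le_card
      (Finset.monotone_filter_right X fun k _ (hk : k < i') => ?_))
    exact (by omega : k < i)
  · intro hlt
    refine Finset.card_lt_card ?_
    rw [Finset.ssubset_iff_of_subset
      (Finset.monotone_filter_right X fun k _ (hk : k < i) => (hk.trans hlt : k < i'))]
    exact ⟨i, by simpa using ⟨hi, hlt⟩, by simp⟩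

theorem exists_card_filter_lt_eq {X : Finset ℕ} {p : ℕ} (hp : p < X.card) :
    ∃ i ∈ X, (X.filter (· < i)).card = p := by
  have himg : X.image (fun i => (X.filter (· < i)).card) = Finset.range X.card := by
    refine Finset.eq_of_subset_of_card_le ?_ ?_
    · intro q hq
      obtain ⟨i, hi, rfl⟩ := Finset.mem_image.1 hq
      refine Finset.mem_range.2 (Finset.card_lt_card ?_)
      exact (Finset.ssubset_iff_of_subset (Finset.filter_subset _ _)).2 ⟨i, hi, by simp⟩
    · rw [Finset.card_range, Finset.card_image_of_injOn (card_filter_lt_injOn X)]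
  have := himg ▸ Finset.mem_range.2 hp
  simpa using this

/-- If all nodes but the two extreme ones are matched into adjacent pairs by `C`, then the arcs
other than those of `C` and the root arc correspond to the inner diagonals of a polygon. -/
theorem exists_bijOn_innerDiagonals {X Y : Finset ℕ} {x y : ℕ} (C : ℕ × ℕ → Prop) (hx : x ∈ X)
    (hy : y ∈ Y) (hxX : ∀ i ∈ X, x ≤ i) (hyX : ∀ i ∈ X, i ≤ y)
    (hyY : ∀ j ∈ Y, j ≤ y) (hX : ∀ i ∈ X, i ≠ x → ∃ j, C (i, j))
    (hY : ∀ j ∈ Y, j ≠ y → ∃ i, C (i, j))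
    (hC : ∀ c, C c → c.1 ∈ X ∧ c.2 ∈ Y ∧ c.1 ≤ c.2 ∧ c ≠ (x, y) ∧
      (∀ i ∈ X, ¬ (c.1 < i ∧ i ≤ c.2)) ∧ ∀ j ∈ Y, ¬ (c.1 ≤ j ∧ j < c.2)) :
    ∃ (d : ℕ) (φ : ℕ × ℕ → ℕ × ℕ), Set.BijOn φ {q | IsInnerDiagonal (d + 3) q}
      {c | (c.1 ∈ X ∧ c.2 ∈ Y ∧ c.1 ≤ c.2) ∧ ¬ C c ∧ c ≠ (x, y)} ∧
      ∀ p q, IsInnerDiagonal (d + 3) p → IsInnerDiagonal (d + 3) q →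
        ((p.1 < q.1 ∧ q.1 < p.2 ∧ p.2 < q.2) ↔ Crossing (φ p) (φ q)) := by
  classical
  -- A matched pair `(i, j)` is to become the edge from `f i` to `f i + 1`, so `j` is placed at the
  -- number of elements of `X` up to `j`. An unmatched `y` has no such edge and receives an extra
  -- last vertex, whence the correction term in `g`.
  let f : ℕ → ℕ := fun i => (X.filter (· < i)).card
  let g : ℕ → ℕ := fun j => f (j + 1) + if j = y ∧ ¬ ∃ i, C (i, j) then 1 else 0
  have hf : ∀ i ∈ X, ∀ i', f i < f i' ↔ i < i' := fun i hi i' => card_filter_lt_lt_iff hi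
  have hfX : ∀ i, f i ≤ X.card := fun i => Finset.card_filter_le _ _
  have hfy : f (y + 1) = X.card :=
    congrArg Finset.card (Finset.filter_true_of_mem (s := X) (p := (· < y + 1))
      fun i hi => Nat.lt_succ_of_le (hyX i hi))
  have hfinj : ∀ i ∈ X, ∀ i' ∈ X, f i = f i' → i = i' := fun i hi i' hi' h =>
    card_filter_lt_injOn X hi hi' h
  have hf_succ : ∀ i j, C (i, j) → f (j + 1) = f i + 1 := by
    intro i j hij
    have h := hC _ hij
    change (X.filter (· < j + 1)).card = (X.filter (· < i)).card + 1
    have : X.filter (· < j + 1) = insert i (X.filter (· < i)) := by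
      ext k
      have h1 := h.2.2.2.2.1 k
      have h2 := h.2.2.1
      simp only [Finset.mem_filter, Finset.mem_insert] at h1 h2 ⊢
      constructor
      · rintro ⟨hk, hkj⟩
        have := h1 hk
        by_cases hki : k = i
        · exact Or.inl hki
        · exact Or.inr ⟨hk, by omega⟩
      · rintro (rfl | ⟨hk, hki⟩)
        · exact ⟨h.1, by omega⟩
        · exact ⟨hk, by omega⟩
    rw [this, Finset.card_insert_of_notMem (by simp)]
  have hg_succ : ∀ i j, C (i, j) → g j = f i + 1 := by
    intro i j hij
    have : ¬ (j = y ∧ ¬ ∃ i, C (i, j)) := fun h => h.2 ⟨i, hij⟩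
    simp only [g, if_neg this, hf_succ i j hij, add_zero]
  have hg_ne : ∀ j, j ≠ y → g j = f (j + 1) := by
    intro j hj
    simp [g, hj]
  have hgy : (∃ i, C (i, y)) ∧ g y = X.card ∨ (¬ ∃ i, C (i, y)) ∧ g y = X.card + 1 := by
    by_cases h : ∃ i, C (i, y)
    · exact Or.inl ⟨h, by simp [g, h, hfy]⟩
    · exact Or.inr ⟨h, by simp [g, h, hfy]⟩
  have hfg : ∀ i ∈ X, ∀ j ∈ Y, f i < g j ↔ i ≤ j := by
    intro i hi j hj
    by_cases hjy : j = y
    · subst hjy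
      have h1 := (hf i hi (j + 1)).2 (Nat.lt_succ_of_le (hyX i hi))
      have h2 : f (j + 1) ≤ g j := Nat.le_add_right _ _
      exact iff_of_true (by omega) (hyX i hi)
    · rw [hg_ne j hjy, hf i hi, Nat.lt_succ_iff]
  have hg_lt : ∀ j ∈ Y, ∀ j' ∈ Y, j < j' → g j < g j' := by
    intro j hj j' hj' hlt
    have hjy : j ≠ y := by have := hyY j' hj'; omega
    rw [hg_ne j hjy]
    by_cases h : ∃ i, C (i, j')
    · obtain ⟨i, hi⟩ := h
      have h1 := hC _ hi
      have h2 := h1.2.2.2.2.2 j hj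
      rw [hg_succ i j' hi]
      have : ¬ f i < f (j + 1) := by
        rw [hf i h1.1]
        simp only at h2
        omega
      omega
    · have hj'y : j' = y := by
        by_contra h'
        exact h (hY j' hj' h')
      subst hj'y
      rcases hgy with hgy | hgy
      · exact absurd hgy.1 h
      · have := hfX (j + 1)
        omega
  have hg_iff : ∀ j ∈ Y, ∀ j' ∈ Y, g j < g j' ↔ j < j' := by
    intro j hj j' hj'
    refine ⟨fun h => ?_, hg_lt j hj j' hj'⟩
    by_contra hle
    rcases (not_lt.1 hle).eq_or_lt with rfl | hlt
    · exact lt_irrefl _ h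
    · exact lt_asymm h (hg_lt j' hj' j hj hlt)
  have hg_inj : ∀ j ∈ Y, ∀ j' ∈ Y, g j = g j' → j = j' := by
    intro j hj j' hj' h
    have h1 := hg_iff j hj j' hj'
    have h2 := hg_iff j' hj' j hj
    omega
  have hgmax : ∀ j ∈ Y, g j ≤ g y := by
    intro j hj
    by_contra hlt
    rw [not_le, hg_iff y hy j hj] at hlt
    have := hyY j hj
    omega
  have hC_iff : ∀ i ∈ X, ∀ j ∈ Y, g j = f i + 1 → C (i, j) := by
    intro i hi j hj h
    by_cases h' : ∃ k, C (k, j)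
    · obtain ⟨k, hk⟩ := h'
      have h1 := hg_succ k j hk
      obtain rfl : k = i := hfinj k (hC _ hk).1 i hi (by omega)
      exact hk
    · have hjy : j = y := by
        by_contra h''
        exact h' (hY j hj h'')
      subst hjy
      have h2 : f i < f (j + 1) := (hf i hi _).2 (Nat.lt_succ_of_le (hyX i hi))
      rcases hgy with hgy | hgy
      · exact absurd hgy.1 h'
      · omega
  have hfx : f x = 0 := by
    refine Finset.card_eq_zero.2 (Finset.filter_eq_empty_iff.2 fun i hi => ?_)
    exact not_lt.2 (hxX i hi)
  -- The polygon has vertices `0, …, g y`, so the dimension is `g y - 2`; this bound makes the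
  -- truncated subtraction harmless. If `y` is matched, its partner differs from `x` because `(x,
  -- y)` is not in `C`.
  have hg2 : 2 ≤ g y := by
    have hpos : 0 < X.card := Finset.card_pos.2 ⟨x, hx⟩
    rcases hgy with ⟨⟨i, hi⟩, hgy⟩ | ⟨_, hgy⟩
    · have h1 := hC _ hi
      have hix : i ≠ x := fun h => h1.2.2.2.1 (h ▸ rfl)
      have h2 : f x < f i := (hf x hx i).2 (lt_of_le_of_ne (hxX i h1.1) (Ne.symm hix))
      have := hg_succ i y hi
      omega
    · omega
  have hN : g y - 2 + 3 = g y + 1 := by omega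
  have hψ : Set.BijOn (fun c : ℕ × ℕ => (f c.1, g c.2))
      {c | (c.1 ∈ X ∧ c.2 ∈ Y ∧ c.1 ≤ c.2) ∧ ¬ C c ∧ c ≠ (x, y)}
      {q | IsInnerDiagonal (g y - 2 + 3) q} := by
    refine ⟨?_, ?_, ?_⟩
    · rintro ⟨i, j⟩ ⟨⟨hi, hj, hij⟩, hc, hne⟩
      have h1 := (hfg i hi j hj).2 hij
      have h2 : g j ≠ f i + 1 := fun h => hc (hC_iff i hi j hj h)
      have h3 := hgmax j hj
      refine ⟨?_, ?_, ?_⟩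
      · simp only at hi hj h1 h2 ⊢
        omega
      · simp only at hi hj h3 ⊢
        omega
      · intro h
        rw [hN, Prod.ext_iff] at h
        simp only [Nat.add_sub_cancel] at h
        refine hne (Prod.ext ?_ ?_)
        · exact hfinj i hi x hx (h.1.trans hfx.symm)
        · exact hg_inj j hj y hy h.2
    · rintro ⟨i, j⟩ ⟨⟨hi, hj, -⟩, -⟩ ⟨i', j'⟩ ⟨⟨hi', hj', -⟩, -⟩ h
      rw [Prod.ext_iff] at h
      exact Prod.ext (hfinj i hi i' hi' h.1) (hg_inj j hj j' hj' h.2)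
    · rintro ⟨p, q⟩ ⟨h1, h2, h3⟩
      rw [hN] at h2 h3
      simp only [Nat.add_sub_cancel, ne_eq, Prod.mk.injEq, not_and] at h1 h2 h3
      have hcard : g y ≤ X.card + 1 := by rcases hgy with h | h <;> omega
      obtain ⟨i, hi, hip⟩ : ∃ i ∈ X, f i = p := exists_card_filter_lt_eq (by omega)
      -- As `p + 1 < q`, the vertex `q - 1` is not `0`. If some element of `X` has that rank, it is
      -- not `x` and its partner sits at `q`; otherwise `q` is the last vertex.
      obtain ⟨j, hj, hjq⟩ : ∃ j ∈ Y, g j = q := by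
        by_cases hq : q - 1 < X.card
        · obtain ⟨k, hk, hkq⟩ : ∃ k ∈ X, f k = q - 1 := exists_card_filter_lt_eq hq
          have hkx : k ≠ x := by
            rintro rfl
            omega
          obtain ⟨j, hj⟩ := hX k hk hkx
          exact ⟨j, (hC _ hj).2.1, by rw [hg_succ k j hj]; omega⟩
        · exact ⟨y, hy, by omega⟩
      refine ⟨(i, j), ⟨⟨hi, hj, (hfg i hi j hj).1 (by omega)⟩, fun hc => ?_, fun hc => ?_⟩,
        Prod.ext hip hjq⟩
      · have := hg_succ i j hc
        omega
      · obtain ⟨rfl, rfl⟩ := Prod.ext_iff.1 hc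
        simp only at hip hjq hfx
        exact h3 (by omega) hjq.symm
  obtain ⟨φ, hinv⟩ : ∃ φ, Set.InvOn φ _ _ _ := ⟨_, hψ.invOn_invFunOn⟩
  refine ⟨g y - 2, φ, hψ.symm hinv.symm, fun p q hp hq => ?_⟩
  have hmap := (hψ.symm hinv.symm).mapsTo
  have h1 := hmap hp
  have h2 := hmap hq
  have h3 := hinv.2 hp
  have h4 := hinv.2 hq
  revert h1 h2 h3 h4
  generalize φ p = a
  generalize φ q = b
  rintro ⟨⟨ha, ha', _⟩, _⟩ ⟨⟨hb, hb', _⟩, _⟩ rfl rfl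
  simp only [crossing_iff]
  rw [hf _ ha, hfg _ hb _ ha', hg_iff _ ha' _ hb']

end Counting

/-! ### Covering forests and polygon diagonals -/

section CoveringForests

theorem isFlag_simplicialAssociahedronBoundary (d : ℕ) :
    IsFlag (simplicialAssociahedronBoundary d) (IsInnerDiagonal (d + 3))
      fun a b => a.1 < b.1 ∧ b.1 < a.2 ∧ a.2 < b.2 :=
  isFlag_ofFaces _ fun _ => Iff.rfl

/-- In the region of `a`, each node other than the ends of `a` is matched by its longest arc in `F`,
and the interior of such an arc is removed from the region. Hence the matched pairs are adjacent, as
the polygon model requires. -/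
theorem exists_bijOn_region {I J : Finset ℕ} {F : Finset (ℕ × ℕ)} (hF : IsForest I J F)
    (hI : ∀ i ∈ I, ∃ j, (i, j) ∈ F) (hJ : ∀ j ∈ J, ∃ i, (i, j) ∈ F) {a : ℕ × ℕ} (ha : a ∈ F) :
    ∃ (d : ℕ) (φ : ℕ × ℕ → ℕ × ℕ), Set.BijOn φ {q | IsInnerDiagonal (d + 3) q}
      {c | IsArc I J c ∧ InRegion F a c ∧ c ∉ F} ∧
      ∀ p q, IsInnerDiagonal (d + 3) p → IsInnerDiagonal (d + 3) q →
        ((p.1 < q.1 ∧ q.1 < p.2 ∧ p.2 < q.2) ↔ Crossing (φ p) (φ q)) := by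
  classical
  have haa := hF.isArc ha
  have haI := Finset.mem_product.1 haa.1
  have hale := haa.2
  let X : Finset ℕ := {i ∈ I | (a.1 ≤ i ∧ i ≤ a.2) ∧
    ∀ b ∈ F, Inside b a → b ≠ a → ¬ (b.1 < i ∧ i ≤ b.2)}
  let Y : Finset ℕ := {j ∈ J | (a.1 ≤ j ∧ j ≤ a.2) ∧
    ∀ b ∈ F, Inside b a → b ≠ a → ¬ (b.1 ≤ j ∧ j < b.2)}
  have hmem : ∀ {i}, i ∈ X ↔ i ∈ I ∧ (a.1 ≤ i ∧ i ≤ a.2) ∧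
      ∀ b ∈ F, Inside b a → b ≠ a → ¬ (b.1 < i ∧ i ≤ b.2) := Finset.mem_filter
  have hmem' : ∀ {j}, j ∈ Y ↔ j ∈ J ∧ (a.1 ≤ j ∧ j ≤ a.2) ∧
      ∀ b ∈ F, Inside b a → b ≠ a → ¬ (b.1 ≤ j ∧ j < b.2) := Finset.mem_filter
  have hXY : ∀ c : ℕ × ℕ, (c.1 ∈ X ∧ c.2 ∈ Y ∧ c.1 ≤ c.2) ↔ IsArc I J c ∧ InRegion F a c := by
    intro c
    simp only [hmem, hmem', IsArc, InRegion, Inside, Finset.mem_product]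
    constructor
    · rintro ⟨⟨h1, h2, h3⟩, ⟨h4, h5, h6⟩, h7⟩
      exact ⟨⟨⟨h1, h4⟩, h7⟩, ⟨h2.1, h5.2⟩, fun b hb hba hne => ⟨h3 b hb hba hne, h6 b hb hba hne⟩⟩
    · rintro ⟨⟨⟨h1, h2⟩, h3⟩, h4, h5⟩
      exact ⟨⟨h1, ⟨h4.1, h3.trans h4.2⟩, fun b hb hba hne => (h5 b hb hba hne).1⟩,
        ⟨h2, ⟨h4.1.trans h3, h4.2⟩, fun b hb hba hne => (h5 b hb hba hne).2⟩, h3⟩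
  have hX : ∀ i ∈ X, i ≠ a.1 → ∃ j, (i, j) ∈ F ∧ (i, j) ≠ a ∧ InRegion F a (i, j) := by
    intro i hi hia
    obtain ⟨hiI, hi1, hi2⟩ := hmem.1 hi
    obtain ⟨j, hj⟩ := hI i hiI
    -- An arc `b` hiding the far end `k` would have to start at `i` itself, since it neither crosses
    -- this arc nor hides `i`; it would then be longer.
    obtain ⟨⟨i', k⟩, hc, hmax⟩ := Finset.exists_max_image (F.filter fun c => c.1 = i)
      (fun c => c.2) ⟨(i, j), by simp [hj]⟩
    obtain ⟨hcF, rfl⟩ := Finset.mem_filter.1 hc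
    have hcle := (hF.isArc hcF).2
    refine ⟨k, hcF, fun h => hia (h ▸ rfl), ⟨hi1.1, ?_⟩, fun b hb hba hne => ⟨hi2 b hb hba hne, ?_⟩⟩
    · have := hF.nonCrossing a ha _ hcF
      rw [crossing_iff] at this
      simp only at this hia hi1 ⊢
      omega
    · rintro ⟨h1, h2⟩
      have h3 := hF.nonCrossing _ hcF b hb
      have h4 := hi2 b hb hba hne
      have h5 := fun h => hmax b (Finset.mem_filter.2 ⟨hb, h⟩)
      rw [crossing_iff] at h3
      simp only at h1 h2 h3 h4 h5 hcle
      omega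
  have hY : ∀ j ∈ Y, j ≠ a.2 → ∃ i, (i, j) ∈ F ∧ (i, j) ≠ a ∧ InRegion F a (i, j) := by
    intro j hj hja
    obtain ⟨hjJ, hj1, hj2⟩ := hmem'.1 hj
    obtain ⟨i, hi⟩ := hJ j hjJ
    obtain ⟨⟨k, j'⟩, hc, hmin⟩ := Finset.exists_min_image (F.filter fun c => c.2 = j)
      (fun c => c.1) ⟨(i, j), by simp [hi]⟩
    obtain ⟨hcF, rfl⟩ := Finset.mem_filter.1 hc
    have hcle := (hF.isArc hcF).2
    refine ⟨k, hcF, fun h => hja (h ▸ rfl), ⟨?_, hj1.2⟩, fun b hb hba hne => ⟨?_, hj2 b hb hba hne⟩⟩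
    · have := hF.nonCrossing _ hcF a ha
      rw [crossing_iff] at this
      simp only at this hja hj1 ⊢
      omega
    · rintro ⟨h1, h2⟩
      have h3 := hF.nonCrossing b hb _ hcF
      have h4 := hj2 b hb hba hne
      have h5 := fun h => hmin b (Finset.mem_filter.2 ⟨hb, h⟩)
      rw [crossing_iff] at h3
      simp only at h1 h2 h3 h4 h5 hcle
      omega
  have hC : ∀ c, (c ∈ F ∧ c ≠ a ∧ InRegion F a c) → c.1 ∈ X ∧ c.2 ∈ Y ∧ c.1 ≤ c.2 ∧
      c ≠ (a.1, a.2) ∧ (∀ i ∈ X, ¬ (c.1 < i ∧ i ≤ c.2)) ∧ ∀ j ∈ Y, ¬ (c.1 ≤ j ∧ j < c.2) := by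
    rintro c ⟨hc, hne, hreg⟩
    have h1 := (hXY c).2 ⟨hF.isArc hc, hreg⟩
    exact ⟨h1.1, h1.2.1, h1.2.2, hne, fun i hi => (hmem.1 hi).2.2 c hc hreg.1 hne,
      fun j hj => (hmem'.1 hj).2.2 c hc hreg.1 hne⟩
  obtain ⟨d, φ, hφ, hcr⟩ := exists_bijOn_innerDiagonals (X := X) (Y := Y) (x := a.1) (y := a.2)
    (fun c => c ∈ F ∧ c ≠ a ∧ InRegion F a c)
    (Finset.mem_filter.2 ⟨haI.1, ⟨le_rfl, hale⟩, fun b _ hba _ h => by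
      simp only [Inside] at hba; omega⟩)
    (Finset.mem_filter.2 ⟨haI.2, ⟨hale, le_rfl⟩, fun b _ hba _ h => by
      simp only [Inside] at hba; omega⟩)
    (fun i hi => (hmem.1 hi).2.1.1) (fun i hi => (hmem.1 hi).2.1.2) (fun j hj => (hmem'.1 hj).2.1.2)
    hX hY hC
  refine ⟨d, φ, ?_, hcr⟩
  convert hφ using 1
  ext c
  simp only [Set.mem_ofPred_eq, hXY, Prod.mk.eta]
  constructor
  · rintro ⟨h1, h2, h3⟩
    exact ⟨⟨h1, h2⟩, fun h => h3 h.1, fun h => h3 (h ▸ ha)⟩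
  · rintro ⟨⟨h1, h2⟩, h3, h4⟩
    exact ⟨h1, h2, fun h => h3 ⟨h, h4, h2⟩⟩

/-- The link of a covering forest is a join of boundaries of simplicial associahedra. -/
theorem exists_isomorphic_link_iJoin {I J : Finset ℕ} {F : Finset (ℕ × ℕ)} {r : ℕ × ℕ}
    (hF : IsForest I J F) (hr : r ∈ F) (hr' : ∀ c ∈ I ×ˢ J, Inside c r)
    (hI : ∀ i ∈ I, ∃ j, (i, j) ∈ F) (hJ : ∀ j ∈ J, ∃ i, (i, j) ∈ F) :
    ∃ (n : ℕ) (d : Fin n → ℕ), Isomorphic (link (tamariComplex I J) F)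
      (iJoin fun k => simplicialAssociahedronBoundary (d k)) := by
  let e : F ≃ Fin F.card := F.equivFin
  choose d φ hφ hcr using fun k : Fin F.card => exists_bijOn_region hF hI hJ (e.symm k).2
  refine ⟨F.card, d, Isomorphic.symm ?_⟩
  refine (IsFlag.iJoin fun k => isFlag_simplicialAssociahedronBoundary (d k)).isomorphic
    (isFlag_link_tamariComplex hF) ?_ not_crossing_self (fun x => φ x.1 x.2) ⟨?_, ?_, ?_⟩ ?_
  · rintro ⟨k, p⟩ h
    exact lt_irrefl _ (sigmaRel_mk.1 h).1
  · rintro ⟨k, p⟩ hp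
    obtain ⟨h1, h2, h3⟩ := (hφ k).mapsTo hp
    exact ⟨h1, h3, compatible_of_inRegion hF hr' h1 (Or.inl (e.symm k).2) h2⟩
  · rintro ⟨k, p⟩ hp ⟨l, q⟩ hq h
    obtain ⟨h1, h2, h3⟩ := (hφ k).mapsTo hp
    obtain ⟨h1', h2', h3'⟩ := (hφ l).mapsTo hq
    have hkl := eq_of_inRegion hF hr' h1 h1' (Or.inl (e.symm k).2) (Or.inl (e.symm l).2) h2 h2'
      (Or.inl fun h => h3 (h ▸ (e.symm k).2)) (Or.inl fun h => h3' (h ▸ (e.symm l).2))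
      (Or.inr (Or.inr h))
    obtain rfl : k = l := e.symm.injective (Subtype.ext hkl)
    obtain rfl : p = q := (hφ k).injOn hp hq h
    rfl
  · rintro c ⟨h1, h2, h3⟩
    obtain ⟨a, ha, h, -⟩ := exists_inRegion hF hr' h1 h3
    have ha : a ∈ F := ha.elim id fun h => h ▸ hr
    obtain ⟨k, hk⟩ := e.symm.surjective ⟨a, ha⟩
    have hk : (e.symm k : ℕ × ℕ) = a := congrArg _ hk
    obtain ⟨p, hp, rfl⟩ := (hφ k).surjOn ⟨h1, hk ▸ h, h2⟩
    exact ⟨⟨k, p⟩, hp, rfl⟩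
  · rintro ⟨k, p⟩ ⟨l, q⟩ hp hq
    obtain ⟨h1, h2, h3⟩ := (hφ k).mapsTo hp
    obtain ⟨h1', h2', h3'⟩ := (hφ l).mapsTo hq
    constructor
    · rintro ⟨m, p', q', hp', hq', h⟩
      cases hp'
      cases hq'
      exact (hcr k p q hp hq).1 h
    · intro h
      have hkl := eq_of_inRegion hF hr' h1 h1' (Or.inl (e.symm k).2) (Or.inl (e.symm l).2) h2 h2'
        (Or.inl fun h => h3 (h ▸ (e.symm k).2)) (Or.inl fun h => h3' (h ▸ (e.symm l).2))
        (Or.inl h)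
      obtain rfl : k = l := e.symm.injective (Subtype.ext hkl)
      exact sigmaRel_mk.2 ((hcr k p q hp hq).2 h)

end CoveringForests

/-! ### Potentials realizing a covering forest -/

section Potentials

/-- Every covering forest is cut out by a dual feasible solution of the transportation problem
with costs `h`. -/
theorem exists_potential (h : ℕ → ℕ → ℝ) {I J : Finset ℕ} {F : Finset (ℕ × ℕ)}
    (hF : IsForest I J F) (hI : ∀ i ∈ I, ∃ j, (i, j) ∈ F) (hJ : ∀ j ∈ J, ∃ i, (i, j) ∈ F)
    (hh : IsNonCrossingHeight I J h) : ∃ u x : ℕ → ℝ, ∀ i ∈ I, ∀ j ∈ J, i ≤ j →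
      x j - u i ≤ h i j ∧ (x j - u i = h i j ↔ (i, j) ∈ F) := by
  induction hn : I.card + J.card using Nat.strong_induction_on generalizing I J F with
  | _ n ih =>
  subst hn
  rcases F.eq_empty_or_nonempty with rfl | hne
  · refine ⟨0, 0, fun i hi => ?_⟩
    obtain ⟨j, hj⟩ := hI i hi
    simp at hj
  -- The induction strips leaves off a shortest arc. Nothing lies between its ends: an arc covering
  -- such a node would be trapped inside and be shorter. The root arc is not required here, because
  -- it may disappear along the way.
  obtain ⟨⟨i, j⟩, hij, hmin⟩ := Finset.exists_min_image F (fun c => c.2 - c.1) hne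
  have hnc : ∀ {i j i' j'}, (i, j) ∈ F → (i', j') ∈ F → ¬ (i < i' ∧ i' ≤ j ∧ j < j') := by
    intro i j i' j' h1 h2
    have := hF.nonCrossing _ h1 _ h2
    rwa [crossing_iff] at this
  have harc : ∀ {i j}, (i, j) ∈ F → i ∈ I ∧ j ∈ J ∧ i ≤ j := fun h =>
    have := hF.isArc h
    ⟨(Finset.mem_product.1 this.1).1, (Finset.mem_product.1 this.1).2, this.2⟩
  have hh' : ∀ {i i' j j'}, i ∈ I → i' ∈ I → j ∈ J → j' ∈ J → i < i' → i' ≤ j → j < j' →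
      h i j' + h i' j < h i j + h i' j' := fun hi hi' hj hj' h1 h2 h3 =>
    hh _ hi _ hi' _ hj _ hj' (bl_lt_bl.2 h1) (bl_lt_wh.2 h2) (wh_lt_wh.2 h3)
  have hmin : ∀ {k l}, (k, l) ∈ F → j - i ≤ l - k := fun h => hmin _ h
  obtain ⟨hi, hj, hle⟩ := harc hij
  have adjI : ∀ k ∈ I, ¬ (i < k ∧ k ≤ j) := by
    rintro k hk ⟨h1, h2⟩
    obtain ⟨l, hl⟩ := hI k hk
    have h3 := hmin hl
    have h4 := hnc hij hl
    have h5 := (harc hl).2.2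
    omega
  have adjJ : ∀ k ∈ J, ¬ (i ≤ k ∧ k < j) := by
    rintro k hk ⟨h1, h2⟩
    obtain ⟨l, hl⟩ := hJ k hk
    have h3 := hmin hl
    have h4 := hnc hl hij
    have h5 := (harc hl).2.2
    omega
  have hsub : ∀ {I' J' F'}, F' ⊆ F → F' ⊆ I' ×ˢ J' → IsForest I' J' F' := fun h1 h2 =>
    ⟨h2, fun a ha => hF.increasing a (h1 ha),
      fun a ha b hb => hF.nonCrossing a (h1 ha) b (h1 hb)⟩
  have hhsub : ∀ {I' J'}, I' ⊆ I → J' ⊆ J → IsNonCrossingHeight I' J' h := fun h1 h2 =>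
    fun a ha b hb c hc d hd => hh a (h1 ha) b (h1 hb) c (h2 hc) d (h2 hd)
  have hcardI := Finset.card_erase_lt_of_mem hi
  have hcardJ := Finset.card_erase_lt_of_mem hj
  -- If `i` has a second arc, then `j` is a leaf and its potential is forced by `(i, j)`. The
  -- non-crossing inequality against `(i, j')` makes every other inequality at `j` strict.
  by_cases hA : ∃ j', j' ≠ j ∧ (i, j') ∈ F
  · obtain ⟨j', hjj', hij'⟩ := hA
    obtain ⟨-, hj', hle'⟩ := harc hij'
    have hlt : j < j' := by
      have := adjJ j' hj'
      omega
    have hleaf : ∀ m, (m, j) ∈ F → m = i := by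
      intro m hm
      have h1 := harc hm
      have h2 := adjI m h1.1
      have h3 := hnc hm hij'
      omega
    obtain ⟨u, x, hux⟩ := ih (I.card + (J.erase j).card) (by omega) (I := I) (J := J.erase j)
      (F := F.filter fun c => c.2 ≠ j)
      (hsub (Finset.filter_subset _ _) fun c hc => by
        obtain ⟨hc, hcj⟩ := Finset.mem_filter.1 hc
        have := harc hc
        simp [this.1, this.2.1, hcj])
      (fun k hk => by
        obtain ⟨l, hl⟩ := hI k hk
        by_cases hlj : l = j
        · subst hlj
          obtain rfl := hleaf k hl
          exact ⟨j', by simp [hij', hjj']⟩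
        · exact ⟨l, by simp [hl, hlj]⟩)
      (fun k hk => by
        obtain ⟨hkj, hk⟩ := Finset.mem_erase.1 hk
        obtain ⟨l, hl⟩ := hJ k hk
        exact ⟨l, by simp [hl, hkj]⟩)
      (hhsub subset_rfl (Finset.erase_subset _ _)) rfl
    refine ⟨u, Function.update x j (u i + h i j), fun i' hi' k hk hik => ?_⟩
    by_cases hkj : k = j
    · subst hkj
      rw [Function.update_self]
      by_cases hii : i' = i
      · subst hii
        simp [hij]
      · have hlti : i' < i := by
          have := adjI i' hi'
          omega
        have h1 := (hux i' hi' j' (by simp [hj', hjj']) (by omega)).1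
        have h2 := (hux i hi j' (by simp [hj', hjj']) (by omega)).2.2 (by simp [hij', hjj'])
        have h3 := hh' hi' hi hj hj' hlti hle hlt
        refine ⟨by linarith, iff_of_false (by linarith) fun hc => hii (hleaf i' hc)⟩
    · rw [Function.update_of_ne hkj]
      have := hux i' hi' k (by simp [hk, hkj]) hik
      simpa [hkj] using this
  by_cases hB : ∃ i', i' ≠ i ∧ (i', j) ∈ F
  · obtain ⟨i', hii', hij'⟩ := hB
    obtain ⟨hi', -, hle'⟩ := harc hij'
    have hlt : i' < i := by
      have := adjI i' hi'
      omega
    have hleaf : ∀ m, (i, m) ∈ F → m = j := by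
      intro m hm
      by_contra hne
      exact hA ⟨m, hne, hm⟩
    obtain ⟨u, x, hux⟩ := ih ((I.erase i).card + J.card) (by omega) (I := I.erase i) (J := J)
      (F := F.filter fun c => c.1 ≠ i)
      (hsub (Finset.filter_subset _ _) fun c hc => by
        obtain ⟨hc, hcj⟩ := Finset.mem_filter.1 hc
        have := harc hc
        simp [this.1, this.2.1, hcj])
      (fun k hk => by
        obtain ⟨hki, hk⟩ := Finset.mem_erase.1 hk
        obtain ⟨l, hl⟩ := hI k hk
        exact ⟨l, by simp [hl, hki]⟩)
      (fun k hk => by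
        obtain ⟨l, hl⟩ := hJ k hk
        by_cases hli : l = i
        · subst hli
          obtain rfl := hleaf k hl
          exact ⟨i', by simp [hij', hii']⟩
        · exact ⟨l, by simp [hl, hli]⟩)
      (hhsub (Finset.erase_subset _ _) subset_rfl) rfl
    refine ⟨Function.update u i (x j - h i j), x, fun m hm k hk hmk => ?_⟩
    by_cases hmi : m = i
    · subst hmi
      rw [Function.update_self]
      by_cases hkj : k = j
      · subst hkj
        simp [hij]
      · have hltj : j < k := by
          have := adjJ k hk
          omega
        have h1 := (hux i' (by simp [hi', hii']) k hk (by omega)).1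
        have h2 := (hux i' (by simp [hi', hii']) j hj hle').2.2 (by simp [hij', hii'])
        have h3 := hh' hi' hi hj hk hlt hle hltj
        refine ⟨by linarith, iff_of_false (by linarith) fun hc => hkj (hleaf k hc)⟩
    · rw [Function.update_of_ne hmi]
      have := hux m (by simp [hm, hmi]) k hk hmk
      simpa [hmi] using this
  · have hleaf : ∀ m, (i, m) ∈ F → m = j := by
      intro m hm
      by_contra hne
      exact hA ⟨m, hne, hm⟩
    have hleaf' : ∀ m, (m, j) ∈ F → m = i := by
      intro m hm
      by_contra hne
      exact hB ⟨m, hne, hm⟩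
    obtain ⟨u, x, hux⟩ := ih ((I.erase i).card + (J.erase j).card) (by omega) (I := I.erase i)
      (J := J.erase j) (F := F.filter fun c => c.1 ≠ i ∧ c.2 ≠ j)
      (hsub (Finset.filter_subset _ _) fun c hc => by
        obtain ⟨hc, hci, hcj⟩ := Finset.mem_filter.1 hc
        have := harc hc
        simp [this.1, this.2.1, hci, hcj])
      (fun k hk => by
        obtain ⟨hki, hk⟩ := Finset.mem_erase.1 hk
        obtain ⟨l, hl⟩ := hI k hk
        have hlj : l ≠ j := by
          rintro rfl
          exact hki (hleaf' k hl)
        exact ⟨l, by simp [hl, hki, hlj]⟩)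
      (fun k hk => by
        obtain ⟨hkj, hk⟩ := Finset.mem_erase.1 hk
        obtain ⟨l, hl⟩ := hJ k hk
        have hli : l ≠ i := by
          rintro rfl
          exact hkj (hleaf k hl)
        exact ⟨l, by simp [hl, hkj, hli]⟩)
      (hhsub (Finset.erase_subset _ _) (Finset.erase_subset _ _)) rfl
    -- The arc is a whole component, so both potentials may be shifted together by a free parameter.
    -- The arcs from `i` give strict lower bounds, those into `j` strict upper bounds; the
    -- non-crossing inequality leaves a gap between them.
    obtain ⟨c, hc1, hc2⟩ := Order.exists_between_finsets
      ((J.filter (j < ·)).image fun k => x k + h i j - h i k)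
      ((I.filter (· < i)).image fun m => u m + h m j) (by
        simp only [Finset.mem_image, Finset.mem_filter]
        rintro _ ⟨k, ⟨hk, hjk⟩, rfl⟩ _ ⟨m, ⟨hm, hmi⟩, rfl⟩
        have h1 := (hux m (by simp [hm, hmi.ne]) k (by simp [hk, hjk.ne']) (by omega)).1
        have h2 := hh' hm hi hj hk hmi hle hjk
        linarith)
    have hc1 : ∀ k ∈ J, j < k → x k + h i j - h i k < c := fun k hk hjk =>
      hc1 _ (Finset.mem_image.2 ⟨k, by simp [hk, hjk], rfl⟩)
    have hc2 : ∀ m ∈ I, m < i → c < u m + h m j := fun m hm hmi =>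
      hc2 _ (Finset.mem_image.2 ⟨m, by simp [hm, hmi], rfl⟩)
    refine ⟨Function.update u i (c - h i j), Function.update x j c, fun m hm k hk hmk => ?_⟩
    by_cases hmi : m = i
    · subst hmi
      rw [Function.update_self]
      by_cases hkj : k = j
      · subst hkj
        simp [hij]
      · have := hc1 k hk (by have := adjJ k hk; omega)
        rw [Function.update_of_ne hkj]
        refine ⟨by linarith, iff_of_false (by linarith) fun hc => hkj (hleaf k hc)⟩
    · rw [Function.update_of_ne hmi]
      by_cases hkj : k = j
      · subst hkj
        have := hc2 m hm (by have := adjI m hm; omega)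
        rw [Function.update_self]
        refine ⟨by linarith, iff_of_false (by linarith) fun hc => hmi (hleaf' m hc)⟩
      · rw [Function.update_of_ne hkj]
        have := hux m (by simp [hm, hmi]) k (by simp [hk, hkj]) hmk
        simpa [hmi, hkj] using this

end Potentials

/-! ### Faces of polyhedra and tight constraints -/

section Polyhedra

variable {E κ : Type*} [NormedAddCommGroup E] [NormedSpace ℝ E]

/-- The polyhedron of solutions of the inequalities `ℓ t x ≤ b t`. -/
def solutions (ℓ : κ → StrongDual ℝ E) (b : κ → ℝ) : Set E := {x | ∀ t, ℓ t x ≤ b t}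

variable {ℓ : κ → StrongDual ℝ E} {b : κ → ℝ}

theorem convex_solutions : Convex ℝ (solutions ℓ b) := by
  intro x hx y hy s t hs ht hst k
  have h1 := mul_le_mul_of_nonneg_left (hx k) hs
  have h2 := mul_le_mul_of_nonneg_left (hy k) ht
  have h3 : s * b k + t * b k = b k := by rw [← add_mul, hst, one_mul]
  rw [map_add, map_smul, map_smul, smul_eq_mul, smul_eq_mul]
  linarith

theorem isClosed_solutions : IsClosed (solutions ℓ b) := by
  have : solutions ℓ b = ⋂ t, {x | ℓ t x ≤ b t} := by
    ext
    simp [solutions]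
  rw [this]
  exact isClosed_iInter fun t => isClosed_le (ℓ t).continuous continuous_const

/-- A segment from `y` to `x` can be prolonged beyond `x` if all constraints that are tight at `x`
are tight at `y`. -/
theorem exists_extension [Finite κ] {x y : E} (hx : x ∈ solutions ℓ b)
    (hxy : ∀ t, ℓ t x = b t → ℓ t y = b t) :
    ∃ ε > (0 : ℝ), x + ε • (x - y) ∈ solutions ℓ b := by
  have : ∀ᶠ ε : ℝ in nhdsWithin 0 (Set.Ioi 0), ∀ t, ℓ t (x + ε • (x - y)) ≤ b t := by
    refine Filter.eventually_all.2 fun t => ?_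
    rcases (hx t).eq_or_lt with h | h
    · refine Filter.Eventually.of_forall fun ε => ?_
      simp [h, hxy t h]
    · have hc : Continuous fun ε : ℝ => ℓ t (x + ε • (x - y)) := by fun_prop
      have h0 : ℓ t (x + (0 : ℝ) • (x - y)) < b t := by simpa using h
      exact ((hc.tendsto 0).eventually_lt_const h0).filter_mono nhdsWithin_le_nhds |>.mono
        fun _ h => h.le
  obtain ⟨ε, h1, h2⟩ := (this.and self_mem_nhdsWithin).exists
  exact ⟨ε, h2, h1⟩

/-- A convex part of a polyhedron contains a point at which as few constraints as possible are
tight. -/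
theorem exists_minimal_tight [Finite κ] {B : Set E} (hB : B ⊆ solutions ℓ b) (hne : B.Nonempty)
    (hconv : Convex ℝ B) : ∃ x ∈ B, ∀ y ∈ B, ∀ t, ℓ t x = b t → ℓ t y = b t := by
  obtain ⟨x, hx, hmin⟩ := (InvImage.wf (fun x : E => {t | ℓ t x = b t}.ncard)
    wellFounded_lt).has_min B hne
  refine ⟨x, hx, fun y hy t ht => by_contra fun hty => ?_⟩
  have hz : (1 / 2 : ℝ) • x + (1 / 2 : ℝ) • y ∈ B :=
    hconv hx hy (by norm_num) (by norm_num) (by norm_num)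
  have hval : ∀ s, ℓ s ((1 / 2 : ℝ) • x + (1 / 2 : ℝ) • y) = (ℓ s x + ℓ s y) / 2 := by
    intro s
    rw [map_add, map_smul, map_smul, smul_eq_mul, smul_eq_mul]
    ring
  -- A constraint is tight at the midpoint only if it is tight at both ends, so the midpoint would
  -- have fewer tight constraints than `x`.
  refine hmin _ hz (Set.ncard_lt_ncard ⟨fun s hs => ?_, fun hsub => hty ?_⟩ (Set.toFinite _))
  · have h1 : _ = b s := hs
    have h2 := hB hx s
    have h3 := hB hy s
    rw [hval] at h1
    change ℓ s x = b s
    linarith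
  · have h1 : _ = b t := hsub ht
    rw [hval] at h1
    linarith

/-- Two extreme points with the same tight constraints coincide, since otherwise the segment joining
them could be prolonged. So there are finitely many, and Krein–Milman applies; the hull of a finite
set is already closed. -/
theorem isPolytope_solutions [Finite κ] (hcomp : IsCompact (solutions ℓ b))
    (hne : (solutions ℓ b).Nonempty) : IsPolytope (solutions ℓ b) := by
  have hinj : Set.InjOn (fun x => {t | ℓ t x = b t}) ((solutions ℓ b).extremePoints ℝ) := by
    intro x hx y hy hxy
    have hxy : ∀ t, ℓ t x = b t → ℓ t y = b t := fun t ht => (Set.ext_iff.1 hxy t).1 ht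
    obtain ⟨ε, hε, hmem⟩ := exists_extension hx.1 hxy
    -- These weights express `x` as a convex combination of `y` and the prolonged point `x + ε • (x
    -- - y)`.
    refine (hx.2 hy.1 hmem ⟨ε / (1 + ε), 1 / (1 + ε), by positivity, by positivity,
      by field_simp; ring, ?_⟩).symm
    match_scalars
    · field_simp
      ring
    · field_simp
  have hfin : ((solutions ℓ b).extremePoints ℝ).Finite := Set.Finite.of_injOn
    (Set.mapsTo_univ _ _) hinj Set.finite_univ
  refine ⟨_, hfin, hcomp.extremePoints_nonempty hne, ?_⟩
  rw [← (hfin.isClosed_convexHull (𝕜 := ℝ)).closure_eq]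
  exact (closure_convexHull_extremePoints hcomp convex_solutions).symm

/-- The face poset of a polyhedron, in terms of the sets of tight constraints. -/
theorem nonempty_polytopeFaces_orderIso [Finite κ] {α : Type*} [PartialOrder α] (A : E → α)
    (hA : ∀ x ∈ solutions ℓ b, ∀ y ∈ solutions ℓ b,
      A x ≤ A y ↔ ∀ t, ℓ t x = b t → ℓ t y = b t) :
    Nonempty (PolytopeFaces (solutions ℓ b) ≃o {a // ∃ x ∈ solutions ℓ b, A x = a}ᵒᵈ) := by
  classical
  cases nonempty_fintype κ
  let f : {a // ∃ x ∈ solutions ℓ b, A x = a}ᵒᵈ ↪o PolytopeFaces (solutions ℓ b) :=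
    OrderEmbedding.ofMapLEIff
      (fun a => ⟨{y ∈ solutions ℓ b | (OrderDual.ofDual a).1 ≤ A y}, by
        obtain ⟨_, x, hx, rfl⟩ := a
        refine ⟨⟨x, hx, le_rfl⟩, fun _ => ?_⟩
        have hle : ∀ y ∈ solutions ℓ b, ∑ t with ℓ t x = b t, ℓ t y ≤
            ∑ t with ℓ t x = b t, ℓ t x := fun y hy =>
          Finset.sum_le_sum fun t ht => (hy t).trans (Finset.mem_filter.1 ht).2.ge
        -- The sum of the functionals tight at `x` is maximal exactly where all of them are tight.
        refine ⟨∑ t with ℓ t x = b t, ℓ t, ?_⟩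
        ext y
        simp only [Set.mem_ofPred_eq, _root_.sum_apply]
        refine and_congr_right fun hy => ?_
        change A x ≤ A y ↔ _
        rw [hA x hx y hy]
        constructor
        · intro h z hz
          refine (hle z hz).trans (Finset.sum_le_sum fun t ht => ?_)
          have := (Finset.mem_filter.1 ht).2
          rw [this, h t this]
        · intro h t ht
          have heq := le_antisymm (hle y hy) (h x hx)
          rw [Finset.sum_eq_sum_iff_of_le fun t ht =>
            (hy t).trans (Finset.mem_filter.1 ht).2.ge] at heq
          rw [heq t (by simpa using ht), ht]⟩)
      (by
        rintro ⟨_, x, hx, rfl⟩ ⟨_, y, hy, rfl⟩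
        constructor
        · intro h
          exact (h (show x ∈ {z ∈ solutions ℓ b | A x ≤ A z} from ⟨hx, le_rfl⟩)).2
        · intro h z hz
          have h : A y ≤ A x := h
          exact ⟨hz.1, h.trans hz.2⟩)
  refine ⟨(RelIso.ofSurjective f ?_).symm⟩
  rintro ⟨B, hBne, hB⟩
  have hsub := hB.subset
  obtain ⟨x, hxB, hmin⟩ := exists_minimal_tight hsub hBne (hB.convex convex_solutions)
  refine ⟨OrderDual.toDual ⟨A x, x, hsub hxB, rfl⟩, Subtype.ext ?_⟩
  change {y ∈ solutions ℓ b | A x ≤ A y} = B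
  ext y
  constructor
  · rintro ⟨hy, hxy⟩
    obtain ⟨l, rfl⟩ := hB hBne
    -- Since `l` is maximal at `x` and the segment from `y` continues past `x`, `l` cannot be
    -- smaller at `y`.
    obtain ⟨ε, hε, hmem⟩ := exists_extension (hsub hxB) ((hA x (hsub hxB) y hy).1 hxy)
    have h1 := hxB.2 _ hmem
    rw [map_add, map_smul, map_sub, smul_eq_mul] at h1
    have h2 : l x ≤ l y := by
      by_contra hlt
      have := mul_pos hε (sub_pos.2 (not_le.1 hlt))
      linarith
    exact ⟨hy, fun z hz => (hxB.2 z hz).trans h2⟩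
  · intro hy
    exact ⟨hsub hy, (hA x (hsub hxB) y (hsub hy)).2 (hmin y hy)⟩

end Polyhedra

/-! ### Products and linear images of polytopes -/

section Products

/-- The face poset of a product of polytopes is the product of the face posets. -/
theorem nonempty_polytopeFaces_pi {ι : Type*} [Finite ι] {E : ι → Type*}
    [∀ k, AddCommGroup (E k)] [∀ k, Module ℝ (E k)] [∀ k, TopologicalSpace (E k)]
    [∀ k, IsTopologicalAddGroup (E k)] (Q : ∀ k, Set (E k)) :
    Nonempty ((∀ k, PolytopeFaces (Q k)) ≃o PolytopeFaces (Set.univ.pi Q)) := by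
  classical
  cases nonempty_fintype ι
  have hmem : ∀ (l : ∀ k, StrongDual ℝ (E k)),
      {x ∈ Set.univ.pi Q | ∀ y ∈ Set.univ.pi Q, ∑ k, l k (y k) ≤ ∑ k, l k (x k)} =
        Set.univ.pi fun k => {x ∈ Q k | ∀ y ∈ Q k, l k y ≤ l k x} := by
    intro l
    ext x
    simp only [Set.mem_ofPred_eq, Set.mem_univ_pi]
    constructor
    · rintro ⟨hx, hmax⟩ k
      refine ⟨hx k, fun y hy => ?_⟩
      have h := hmax (Function.update x k y) fun m => by
        by_cases hm : m = k
        · subst hm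
          simpa using hy
        · simpa [hm] using hx m
      rw [← Finset.add_sum_erase _ _ (Finset.mem_univ k),
        ← Finset.add_sum_erase _ (fun k => l k (x k)) (Finset.mem_univ k),
        Function.update_self] at h
      have h' : ∑ m ∈ Finset.univ.erase k, l m (Function.update x k y m) =
          ∑ m ∈ Finset.univ.erase k, l m (x m) := Finset.sum_congr rfl fun m hm => by
        rw [Function.update_of_ne (Finset.ne_of_mem_erase hm)]
      linarith
    · intro h
      exact ⟨fun k => (h k).1, fun y hy => Finset.sum_le_sum fun k _ => (h k).2 _ (hy k)⟩
  let f : (∀ k, PolytopeFaces (Q k)) ↪o PolytopeFaces (Set.univ.pi Q) :=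
    OrderEmbedding.ofMapLEIff
      (fun B => ⟨Set.univ.pi fun k => (B k).1, Set.univ_pi_nonempty_iff.2 fun k => (B k).2.1, by
        intro _
        choose l hl using fun k => (B k).2.2 (B k).2.1
        refine ⟨∑ k, (l k).comp (ContinuousLinearMap.proj k), ?_⟩
        simp only [_root_.sum_apply, ContinuousLinearMap.comp_apply,
          ContinuousLinearMap.proj_apply]
        rw [hmem l]
        exact congrArg _ (funext hl)⟩)
      (by
        intro B B'
        change Set.univ.pi _ ⊆ Set.univ.pi _ ↔ _
        rw [Set.univ_pi_subset_univ_pi_iff, or_iff_left]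
        · rfl
        · rintro ⟨k, hk⟩
          exact (B k).2.1.ne_empty hk)
  refine ⟨RelIso.ofSurjective f ?_⟩
  rintro ⟨B, hBne, hB⟩
  obtain ⟨l, hl⟩ := hB hBne
  -- A functional on the product is a sum of functionals of single coordinates, so the face it
  -- exposes is a product of exposed faces.
  let l' : ∀ k, StrongDual ℝ (E k) := fun k => l.comp (ContinuousLinearMap.single ℝ E k)
  have hsum : ∀ x, l x = ∑ k, l' k (x k) := fun x => by
    conv_lhs => rw [← Finset.univ_sum_single x, map_sum]
    rfl
  simp only [hsum] at hl
  rw [hmem l'] at hl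
  have hne : ∀ k, {x ∈ Q k | ∀ y ∈ Q k, l' k y ≤ l' k x}.Nonempty :=
    Set.univ_pi_nonempty_iff.1 (hl ▸ hBne)
  exact ⟨fun k => ⟨_, hne k, fun _ => ⟨l' k, rfl⟩⟩, Subtype.ext hl.symm⟩

theorem isExposed_image {E E' : Type*} [AddCommGroup E] [Module ℝ E]
    [TopologicalSpace E] [AddCommGroup E'] [Module ℝ E'] [TopologicalSpace E'] (e : E ≃L[ℝ] E')
    {P B : Set E} (hB : IsExposed ℝ P B) : IsExposed ℝ (e '' P) (e '' B) := by
  intro hne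
  obtain ⟨l, rfl⟩ := hB (Set.image_nonempty.1 hne)
  refine ⟨l.comp (e.symm : E' →L[ℝ] E), ?_⟩
  ext y
  obtain ⟨x, rfl⟩ := e.surjective y
  simp [e.injective.mem_set_image]

/-- Linear isomorphisms preserve face posets. -/
theorem combinatoriallyIsomorphic_image {E E' : Type*} [AddCommGroup E] [Module ℝ E]
    [TopologicalSpace E] [AddCommGroup E'] [Module ℝ E'] [TopologicalSpace E'] (e : E ≃L[ℝ] E')
    (P : Set E) : CombinatoriallyIsomorphic P (e '' P) := by
  refine ⟨{ toFun := fun B => ⟨e '' B.1, B.2.1.image e, isExposed_image e B.2.2⟩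
            invFun := fun B => ⟨e.symm '' B.1, B.2.1.image e.symm, ?_⟩
            left_inv := ?_
            right_inv := ?_
            map_rel_iff' := ?_ }⟩
  · have := isExposed_image e.symm B.2.2
    rwa [e.symm_image_image] at this
  · exact fun B => Subtype.ext (e.symm_image_image B.1)
  · exact fun B => Subtype.ext (e.image_symm_image B.1)
  · intro B B'
    exact Set.image_subset_image_iff e.injective

theorem IsPolytope.image {E E' : Type*} [AddCommGroup E] [Module ℝ E]
    [TopologicalSpace E] [AddCommGroup E'] [Module ℝ E'] [TopologicalSpace E'] {P : Set E}
    (hP : IsPolytope P) (e : E ≃L[ℝ] E') : IsPolytope (e '' P) := by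
  obtain ⟨s, hs, hne, rfl⟩ := hP
  exact ⟨e '' s, hs.image e, hne.image e, (e : E →ₗ[ℝ] E').image_convexHull s⟩

end Products

/-! ### Cells of the associahedron and their faces -/

section Cells

variable {I J : Finset ℕ} {hJ : J.Nonempty} {h : ℕ → ℕ → ℝ} {G : Finset (ℕ × ℕ)}

theorem mem_sector {i : ℕ} {j : J} {x : J → ℝ} : x ∈ sector J h i j ↔
    i ≤ j ∧ ∀ k : J, i ≤ k → - h i k + x k ≤ - h i j + x j := by
  simp only [sector, argmax, bl_lt_wh, Set.mem_ofPred_eq]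

theorem mem_polyhedron {x : J → ℝ} : x ∈ polyhedron J hJ h G ↔
    x ⟨J.max' hJ, J.max'_mem hJ⟩ = 0 ∧ ∀ i, ∀ j : J, (i, (j : ℕ)) ∈ G → x ∈ sector J h i j :=
  Iff.rfl

open Classical in
/-- The arcs `(i, j)` such that the maximum for `i` is attained at `j`. -/
noncomputable def activeArcs (I J : Finset ℕ) (h : ℕ → ℕ → ℝ) (x : J → ℝ) : Finset (ℕ × ℕ) :=
  {a ∈ I ×ˢ J | ∃ hj : a.2 ∈ J, x ∈ sector J h a.1 ⟨a.2, hj⟩}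

theorem mem_activeArcs {i : ℕ} {j : J} {x : J → ℝ} :
    (i, (j : ℕ)) ∈ activeArcs I J h x ↔ i ∈ I ∧ x ∈ sector J h i j := by
  simp [activeArcs]

theorem activeArcs_subset (x : J → ℝ) : activeArcs I J h x ⊆ I ×ˢ J := by
  classical
  exact Finset.filter_subset _ _

theorem subset_activeArcs_iff (hG : G ⊆ I ×ˢ J) {x : J → ℝ} : G ⊆ activeArcs I J h x ↔
    ∀ i, ∀ j : J, (i, (j : ℕ)) ∈ G → x ∈ sector J h i j := by
  constructor
  · exact fun hx i j hij => (mem_activeArcs.1 (hx hij)).2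
  · rintro hx ⟨i, j⟩ hij
    obtain ⟨hi, hj⟩ := Finset.mem_product.1 (hG hij)
    exact mem_activeArcs (j := ⟨j, hj⟩).2 ⟨hi, hx i ⟨j, hj⟩ hij⟩

theorem mem_polyhedron_iff_subset (hG : G ⊆ I ×ˢ J) {x : J → ℝ} : x ∈ polyhedron J hJ h G ↔
    x ⟨J.max' hJ, J.max'_mem hJ⟩ = 0 ∧ G ⊆ activeArcs I J h x := by
  rw [mem_polyhedron, subset_activeArcs_iff hG]

/-- For crossing arcs `(i, j)`, `(i', j')`, maximality at `j` for `i` and at `j'` for `i'` adds up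
to the reverse of the non-crossing inequality, the coordinates of `x` cancelling. -/
theorem isForest_activeArcs (hh : IsNonCrossingHeight I J h) (x : J → ℝ) :
    IsForest I J (activeArcs I J h x) := by
  refine ⟨activeArcs_subset x, ?_, ?_⟩
  · rintro ⟨i, j⟩ ha
    obtain ⟨-, hj⟩ := Finset.mem_product.1 (activeArcs_subset x ha)
    have := mem_activeArcs (j := ⟨j, hj⟩).1 ha
    exact bl_lt_wh.2 (mem_sector.1 this.2).1
  · rintro ⟨i, j⟩ ha ⟨i', j'⟩ ha' hcr
    obtain ⟨hi, hj⟩ := Finset.mem_product.1 (activeArcs_subset x ha)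
    obtain ⟨hi', hj'⟩ := Finset.mem_product.1 (activeArcs_subset x ha')
    have h1 := mem_sector.1 (mem_activeArcs (j := ⟨j, hj⟩).1 ha).2
    have h2 := mem_sector.1 (mem_activeArcs (j := ⟨j', hj'⟩).1 ha').2
    have h3 := hh i hi i' hi' j hj j' hj' hcr.1 hcr.2.1 hcr.2.2
    rw [crossing_iff] at hcr
    have h4 := h1.2 ⟨j', hj'⟩ (by simp only at hcr ⊢; omega)
    have h5 := h2.2 ⟨j, hj⟩ hcr.2.1
    simp only at h4 h5
    linarith

/-- The realization of a covering forest by a point. -/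
theorem exists_activeArcs_eq (hh : IsNonCrossingHeight I J h) (hG : IsForest I J G)
    (hGI : ∀ i ∈ I, ∃ j, (i, j) ∈ G) (hGJ : ∀ j ∈ J, ∃ i, (i, j) ∈ G) :
    ∃ x : J → ℝ, x ⟨J.max' hJ, J.max'_mem hJ⟩ = 0 ∧ activeArcs I J h x = G := by
  obtain ⟨u, x, hux⟩ := exists_potential h hG hGI hGJ hh
  refine ⟨fun j => x j - x (J.max' hJ), sub_self _, ?_⟩
  ext ⟨i, j⟩
  constructor
  · intro ha
    obtain ⟨hi, hj⟩ := Finset.mem_product.1 (activeArcs_subset _ ha)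
    obtain ⟨hij, hmax⟩ := mem_sector.1 (mem_activeArcs (j := ⟨j, hj⟩).1 ha).2
    obtain ⟨k, hk⟩ := hGI i hi
    obtain ⟨hk1, hk2⟩ := hG.isArc hk
    have hkJ := (Finset.mem_product.1 hk1).2
    have h1 := hmax ⟨k, hkJ⟩ hk2
    have h2 := (hux i hi k hkJ hk2).2.2 hk
    have h3 := hux i hi j hj hij
    simp only at h1
    exact h3.2.1 (by linarith)
  · intro ha
    obtain ⟨h1, hij⟩ := hG.isArc ha
    obtain ⟨hi, hj⟩ := Finset.mem_product.1 h1
    refine mem_activeArcs (j := ⟨j, hj⟩).2 ⟨hi, mem_sector.2 ⟨hij, fun k hk => ?_⟩⟩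
    have h2 := (hux i hi j hj hij).2.2 ha
    have h3 := (hux i hi k k.2 hk).1
    simp only
    linarith

/-- A bounded polyhedron has no direction of recession. -/
theorem not_isBounded_of_recession {x : J → ℝ} (hx : x ∈ polyhedron J hJ h G)
    (T : Set J) {k l : J} (hk : k ∈ T) (hl : l ∉ T)
    (hT : ∀ i, ∀ j ∈ T, (i, (j : ℕ)) ∈ G → ∀ k : J, i ≤ k → k ∈ T) :
    ¬ Bornology.IsBounded (polyhedron J hJ h G) := by
  classical
  intro hb
  set j₀ : J := ⟨J.max' hJ, J.max'_mem hJ⟩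
  obtain ⟨R, hR⟩ := isBounded_iff_forall_norm_le.1 hb
  -- Moving along `v` preserves every maximum prescribed by `G`: at a column in `T` all competitors
  -- are in `T` too, and elsewhere `v` is already maximal. Subtracting `v j₀` keeps the
  -- normalization.
  let v : J → ℝ := fun j => if j ∈ T then 0 else 1
  have hmem : ∀ s : ℝ, 0 ≤ s → (fun j => x j + s * (v j - v j₀)) ∈ polyhedron J hJ h G := by
    intro s hs
    refine mem_polyhedron.2 ⟨?_, fun i j hij => ?_⟩
    · have := hx.1
      change x j₀ + s * (v j₀ - v j₀) = 0
      rw [show x j₀ = 0 from this]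
      ring
    · obtain ⟨h1, h2⟩ := mem_sector.1 (hx.2 i j hij)
      refine mem_sector.2 ⟨h1, fun k hk => ?_⟩
      have h3 := h2 k hk
      have h4 : v k ≤ v j := by
        by_cases hj : j ∈ T
        · have := hT i j hj hij k hk
          simp [v, this, hj]
        · by_cases hk : k ∈ T <;> simp [v, hj, hk]
      have h5 := mul_le_mul_of_nonneg_left h4 hs
      linarith
  have hbound : ∀ m : J, ∀ s : ℝ, 0 ≤ s → |x m + s * (v m - v j₀)| ≤ R := fun m s hs =>
    (norm_le_pi_norm (fun j => x j + s * (v j - v j₀)) m).trans (hR _ (hmem s hs))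
  have hR0 : 0 ≤ R := (norm_nonneg _).trans (hR x hx)
  -- Normalization freezes the side of `j₀`; a column on the other side runs off to infinity,
  -- upwards for `l` or downwards for `k`.
  by_cases hj₀ : j₀ ∈ T
  · have := hbound l (R + |x l| + 1) (by positivity)
    simp only [v, hl, hj₀, if_true, if_false] at this
    have h1 := le_abs_self (x l + (R + |x l| + 1) * (1 - 0))
    have h2 := neg_abs_le (x l)
    linarith
  · have := hbound k (R + |x k| + 1) (by positivity)
    simp only [v, hk, hj₀, if_true, if_false] at this
    have h1 := neg_abs_le (x k + (R + |x k| + 1) * (0 - 1))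
    have h2 := le_abs_self (x k)
    linarith

theorem exists_coveringForest_of_mem_cells {hI : I.Nonempty}
    (hh : IsNonCrossingHeight I J h) {C : Set (J → ℝ)} (hC : C ∈ associahedronCells I J hJ h) :
    ∃ G, IsCoveringForest I J hI hJ G ∧ C = polyhedron J hJ h G := by
  obtain ⟨⟨x, hx⟩, hb, G, hG, hGI, rfl⟩ := hC
  have hGx := ((mem_polyhedron_iff_subset hG).1 hx).2
  have hfor := isForest_activeArcs hh x
  have hGF : IsForest I J G := ⟨hG, fun a ha => hfor.increasing a (hGx ha),
    fun a ha b hb => hfor.nonCrossing a (hGx ha) b (hGx hb)⟩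
  refine ⟨G, ⟨hGF, ?_, hGI, ?_⟩, rfl⟩
  · by_contra hroot
    have hi₀ := I.min'_mem hI
    obtain ⟨j, hj⟩ := hGI _ hi₀
    -- Let `k` be the farthest column joined to the minimal node. An arc ending beyond `k` must also
    -- start beyond `k`, by maximality and non-crossing, so the columns beyond `k` form a recession
    -- set.
    obtain ⟨⟨i, k⟩, hk, hkmax⟩ := Finset.exists_max_image (G.filter fun c => c.1 = I.min' hI)
      (fun c => c.2) ⟨(I.min' hI, j), by simp [hj]⟩
    obtain ⟨hkG, rfl⟩ := Finset.mem_filter.1 hk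
    have hkJ := (Finset.mem_product.1 (hG hkG)).2
    simp only at hkJ
    have hlt : k < J.max' hJ := lt_of_le_of_ne (J.le_max' k hkJ) fun h' => by
      subst h'
      exact hroot hkG
    refine not_isBounded_of_recession hx {m | k < (m : ℕ)} (k := ⟨_, J.max'_mem hJ⟩)
      (l := ⟨k, hkJ⟩) hlt (lt_irrefl k) (fun i' m hm him p hp => ?_) hb
    have hm : k < m := hm
    have h1 := hGF.nonCrossing _ hkG _ him
    have h2 := fun h => hkmax (i', (m : ℕ)) (Finset.mem_filter.2 ⟨him, h⟩)
    have h3 := I.min'_le i' (Finset.mem_product.1 (hG him)).1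
    rw [crossing_iff] at h1
    simp only [Set.mem_ofPred_eq] at h1 h2 h3 ⊢
    omega
  · intro j hj
    by_contra hun
    by_cases hex : ∃ l ∈ J, l ≠ j
    · obtain ⟨l, hl, hlj⟩ := hex
      refine not_isBounded_of_recession hx {⟨j, hj⟩} (k := ⟨j, hj⟩) (l := ⟨l, hl⟩) rfl
        (by simpa using hlj) (fun i m hm him => ?_) hb
      obtain rfl : m = ⟨j, hj⟩ := hm
      exact absurd ⟨i, him⟩ hun
    · obtain ⟨i, hi⟩ := hI
      obtain ⟨k, hk⟩ := hGI i hi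
      have hkJ := (Finset.mem_product.1 (hG hk)).2
      obtain rfl : k = j := by
        by_contra hne
        exact hex ⟨k, hkJ, hne⟩
      exact hun ⟨i, hk⟩

/-- The root arc compares every column with the normalized one and bounds it above; any arc of `G`
ending at the column bounds it below. The order hypotheses make both comparisons finite. -/
theorem isBounded_polyhedron {hI : I.Nonempty} (hmin : ∀ j ∈ J, bl (I.min' hI) < wh j)
    (hmax : ∀ i ∈ I, bl i < wh (J.max' hJ)) (hG : IsCoveringForest I J hI hJ G) :
    Bornology.IsBounded (polyhedron J hJ h G) := by
  classical
  rw [← Bornology.forall_isBounded_image_eval_iff]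
  intro j
  obtain ⟨i, hi⟩ := hG.right_covered j j.2
  have hiI := (Finset.mem_product.1 (hG.subset hi)).1
  set j₀ : J := ⟨J.max' hJ, J.max'_mem hJ⟩
  refine (Metric.isBounded_Icc (h i j - h i j₀)
    (h (I.min' hI) j - h (I.min' hI) j₀)).subset ?_
  rintro _ ⟨x, hx, rfl⟩
  have h0 : x j₀ = 0 := hx.1
  have h1 := (mem_sector.1 (hx.2 i j hi)).2 j₀ (bl_lt_wh.1 (hmax i hiI))
  have h2 := (mem_sector.1 (hx.2 (I.min' hI) j₀ hG.root_mem)).2 j (bl_lt_wh.1 (hmin j j.2))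
  rw [h0] at h1 h2
  exact ⟨by simp only [Function.eval]; linarith, by simp only [Function.eval]; linarith⟩

/-- The linear functionals in the inequalities that define `polyhedron J hJ h G`. -/
noncomputable def constraintFunctional (I : Finset ℕ) (hJ : J.Nonempty) (G : Finset (ℕ × ℕ)) :
    {t : I × J × J // ((t.1 : ℕ), (t.2.1 : ℕ)) ∈ G ∧ (t.1 : ℕ) ≤ t.2.2} ⊕ Bool →
      StrongDual ℝ (J → ℝ) :=
  let p : J → StrongDual ℝ (J → ℝ) := ContinuousLinearMap.proj
  Sum.elim (fun t => p t.1.2.2 - p t.1.2.1) fun s =>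
    cond s (p ⟨J.max' hJ, J.max'_mem hJ⟩) (- p ⟨J.max' hJ, J.max'_mem hJ⟩)

/-- The right hand sides of the inequalities that define `polyhedron J hJ h G`. -/
def constraintBound (I J : Finset ℕ) (h : ℕ → ℕ → ℝ) (G : Finset (ℕ × ℕ)) :
    {t : I × J × J // ((t.1 : ℕ), (t.2.1 : ℕ)) ∈ G ∧ (t.1 : ℕ) ≤ t.2.2} ⊕ Bool → ℝ :=
  Sum.elim (fun t => h t.1.1 t.1.2.2 - h t.1.1 t.1.2.1) fun _ => 0

theorem polyhedron_eq_solutions (hG : IsForest I J G) : polyhedron J hJ h G =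
    solutions (constraintFunctional I hJ G) (constraintBound I J h G) := by
  ext x
  rw [mem_polyhedron]
  simp only [solutions, Set.mem_ofPred_eq, Sum.forall, constraintFunctional, constraintBound,
    Sum.elim_inl, Sum.elim_inr, Bool.forall_bool, cond_true, cond_false, _root_.sub_apply,
    _root_.neg_apply, ContinuousLinearMap.proj_apply]
  rw [and_comm]
  refine and_congr ?_ ?_
  · constructor
    · rintro hx ⟨⟨i, j, k⟩, hij, hik⟩
      have := (mem_sector.1 (hx i j hij)).2 k hik
      simp only
      linarith
    · intro hx i j hij
      obtain ⟨h1, h2⟩ := hG.isArc hij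
      refine mem_sector.2 ⟨h2, fun k hk => ?_⟩
      have := hx ⟨⟨⟨i, (Finset.mem_product.1 h1).1⟩, j, k⟩, hij, hk⟩
      simp only at this
      linarith
  · constructor
    · intro hx
      simp [hx]
    · rintro ⟨h1, h2⟩
      linarith

/-- Once `(i, j) ∈ G` fixes the maximum for `i`, equality in the comparison with `k` means that the
maximum is attained at `k` as well. Each `i` needs an arc of `G` to serve as reference. -/
theorem activeArcs_subset_iff_tight (hG : IsForest I J G) (hGI : ∀ i ∈ I, ∃ j, (i, j) ∈ G)
    {x y : J → ℝ} (hx : x ∈ polyhedron J hJ h G) (hy : y ∈ polyhedron J hJ h G) :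
    activeArcs I J h x ⊆ activeArcs I J h y ↔
      ∀ t, constraintFunctional I hJ G t x = constraintBound I J h G t →
        constraintFunctional I hJ G t y = constraintBound I J h G t := by
  have tight : ∀ {z : J → ℝ}, z ∈ polyhedron J hJ h G → ∀ {i : ℕ} {j k : J},
      (i, (j : ℕ)) ∈ G → i ≤ k → (z k - z j = h i k - h i j ↔ z ∈ sector J h i k) := by
    intro z hz i j k hij hik
    obtain ⟨h1, h2⟩ := mem_sector.1 (hz.2 i j hij)
    rw [mem_sector]
    constructor
    · refine fun heq => ⟨hik, fun l hl => ?_⟩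
      have := h2 l hl
      linarith
    · intro h3
      have h4 := h3.2 j h1
      have h5 := h2 k hik
      linarith
  simp only [Sum.forall, constraintFunctional, constraintBound, Sum.elim_inl, Sum.elim_inr,
    Bool.forall_bool, cond_true, cond_false, _root_.sub_apply, _root_.neg_apply,
    ContinuousLinearMap.proj_apply]
  have hx0 := hx.1
  have hy0 := hy.1
  constructor
  · intro hsub
    refine ⟨?_, by simp [hy0], by simp [hy0]⟩
    rintro ⟨⟨⟨i, hi⟩, j, k⟩, hij, hik⟩ ht
    rw [tight hx hij hik] at ht
    rw [tight hy hij hik]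
    exact (mem_activeArcs.1 (hsub (mem_activeArcs.2 ⟨hi, ht⟩))).2
  · rintro ⟨ht, -⟩
    rw [subset_activeArcs_iff (activeArcs_subset x)]
    intro i k hik
    obtain ⟨hi, hk⟩ := mem_activeArcs.1 hik
    obtain ⟨j, hij⟩ := hGI i hi
    have hjJ := (Finset.mem_product.1 (hG.subset hij)).2
    have hle := (mem_sector.1 hk).1
    have := ht ⟨⟨⟨i, hi⟩, ⟨j, hjJ⟩, k⟩, hij, hle⟩
    exact (tight hy (j := ⟨j, hjJ⟩) hij hle).1
      (this ((tight hx (j := ⟨j, hjJ⟩) hij hle).2 hk))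

/-- The faces of the link of a forest are the forests that contain it. -/
theorem nonempty_facePoset_link_orderIso (hG : IsForest I J G) :
    Nonempty (FacePoset (link (tamariComplex I J) G) ≃o {F // IsForest I J F ∧ G ⊆ F}) := by
  have hface : ∀ s, IsFace (link (tamariComplex I J) G) s ↔
      Disjoint s G ∧ IsForest I J (s ∪ G) := fun s => by
    rw [isFace_link_iff ((isFace_tamariComplex G).2 hG), isFace_tamariComplex]
  let f : FacePoset (link (tamariComplex I J) G) ↪o {F // IsForest I J F ∧ G ⊆ F} :=
    OrderEmbedding.ofMapLEIff
      (fun s => ⟨s.1 ∪ G, ((hface s.1).1 s.2).2, Finset.subset_union_right⟩)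
      (fun s t => by
        change s.1 ∪ G ⊆ t.1 ∪ G ↔ s.1 ⊆ t.1
        have hs := Finset.disjoint_left.1 ((hface s.1).1 s.2).1
        constructor
        · intro hst a ha
          exact (Finset.mem_union.1 (hst (Finset.mem_union_left _ ha))).resolve_right (hs ha)
        · exact fun hst => Finset.union_subset_union hst subset_rfl)
  refine ⟨RelIso.ofSurjective f ?_⟩
  rintro ⟨F, hF, hGF⟩
  refine ⟨⟨F \ G, (hface _).2 ⟨Finset.sdiff_disjoint, ?_⟩⟩, Subtype.ext ?_⟩
  · rwa [Finset.sdiff_union_of_subset hGF]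
  · exact Finset.sdiff_union_of_subset hGF

theorem isPolytope_polyhedron {hI : I.Nonempty} (hmin : ∀ j ∈ J, bl (I.min' hI) < wh j)
    (hmax : ∀ i ∈ I, bl i < wh (J.max' hJ)) (hh : IsNonCrossingHeight I J h)
    (hG : IsCoveringForest I J hI hJ G) : IsPolytope (polyhedron J hJ h G) := by
  obtain ⟨x, hx0, hx⟩ := exists_activeArcs_eq (hJ := hJ) hh hG.toIsForest hG.left_covered
    hG.right_covered
  have hne : (polyhedron J hJ h G).Nonempty :=
    ⟨x, (mem_polyhedron_iff_subset hG.subset).2 ⟨hx0, hx.ge⟩⟩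
  have hb := isBounded_polyhedron (h := h) hmin hmax hG
  rw [polyhedron_eq_solutions hG.toIsForest] at hne hb ⊢
  exact isPolytope_solutions (Metric.isCompact_of_isClosed_isBounded isClosed_solutions hb) hne

/-- The face poset of the cell of a covering forest is anti-isomorphic to the face poset of the
link of the forest. -/
theorem nonempty_polytopeFaces_polyhedron (hh : IsNonCrossingHeight I J h) (hG : IsForest I J G)
    (hGI : ∀ i ∈ I, ∃ j, (i, j) ∈ G) (hGJ : ∀ j ∈ J, ∃ i, (i, j) ∈ G) :
    Nonempty (PolytopeFaces (polyhedron J hJ h G) ≃o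
      (FacePoset (link (tamariComplex I J) G))ᵒᵈ) := by
  have hP := polyhedron_eq_solutions (hJ := hJ) (h := h) hG
  have htight : ∀ x ∈ solutions (constraintFunctional I hJ G) (constraintBound I J h G),
      ∀ y ∈ solutions (constraintFunctional I hJ G) (constraintBound I J h G),
      activeArcs I J h x ≤ activeArcs I J h y ↔
        ∀ t, constraintFunctional I hJ G t x = constraintBound I J h G t →
          constraintFunctional I hJ G t y = constraintBound I J h G t := by
    rw [← hP]
    exact fun x hx y hy => activeArcs_subset_iff_tight hG hGI hx hy
  obtain ⟨e⟩ := nonempty_polytopeFaces_orderIso (activeArcs I J h) htight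
  obtain ⟨e'⟩ := nonempty_facePoset_link_orderIso hG
  have hset : ∀ F, (∃ x ∈ solutions (constraintFunctional I hJ G) (constraintBound I J h G),
      activeArcs I J h x = F) ↔ IsForest I J F ∧ G ⊆ F := by
    rw [← hP]
    refine fun F => ⟨?_, fun ⟨hF, hGF⟩ => ?_⟩
    · rintro ⟨x, hx, rfl⟩
      exact ⟨isForest_activeArcs hh x, ((mem_polyhedron_iff_subset hG.subset).1 hx).2⟩
    · obtain ⟨x, hx0, hx⟩ := exists_activeArcs_eq (hJ := hJ) hh hF
        (fun i hi => (hGI i hi).imp fun _ h => hGF h) fun j hj => (hGJ j hj).imp fun _ h => hGF h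
      exact ⟨x, (mem_polyhedron_iff_subset hG.subset).2 ⟨hx0, hx ▸ hGF⟩, hx⟩
  let m : {F // ∃ x ∈ solutions (constraintFunctional I hJ G) (constraintBound I J h G),
      activeArcs I J h x = F} ≃o {F // IsForest I J F ∧ G ⊆ F} :=
    { toEquiv := Equiv.subtypeEquivRight hset
      map_rel_iff' := Iff.rfl }
  rw [hP]
  exact ⟨e.trans (m.trans e'.symm).dual⟩

end Cells

/-! ### Realizing associahedra and assembling products -/

section Associahedra

/-- Classical associahedra exist in all dimensions. -/
theorem exists_isAssociahedron (d : ℕ) :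
    ∃ (m : ℕ) (Q : Set (Fin m → ℝ)), IsAssociahedron d Q := by
  classical
  let I : Finset ℕ := Finset.range (d + 2)
  have hI : I.Nonempty := ⟨0, by simp [I]⟩
  have hminI : I.min' hI = 0 := Nat.eq_zero_of_le_zero (I.min'_le 0 (by simp [I]))
  have hmaxI : I.max' hI = d + 1 := le_antisymm
    (Finset.max'_le _ _ _ fun j hj => by have := Finset.mem_range.1 hj; omega)
    (I.le_max' _ (by simp [I]))
  -- With barred `j` placed at vertex `j + 1`, the arcs `(s, s)` are the edges from `s` to `s + 1`
  -- and the root arc closes up a `(d + 3)`-gon. The link of `G` is then a single boundary complex.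
  let G : Finset (ℕ × ℕ) := insert (0, d + 1) (I.image fun s => (s, s))
  have hmemG : ∀ c, c ∈ G ↔ c = (0, d + 1) ∨ c.1 = c.2 ∧ c.1 < d + 2 := by
    rintro ⟨i, j⟩
    simp only [G, I, Finset.mem_insert, Finset.mem_image, Finset.mem_range, Prod.mk.injEq]
    refine or_congr_right ⟨?_, ?_⟩
    · rintro ⟨s, hs, rfl, rfl⟩
      exact ⟨rfl, hs⟩
    · rintro ⟨rfl, hs⟩
      exact ⟨i, hs, rfl, rfl⟩
  have hcompat : ∀ c : ℕ × ℕ, c.2 < d + 2 → Compatible G c := by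
    intro c hc b hb
    rw [crossing_iff, crossing_iff]
    rcases (hmemG b).1 hb with rfl | hb
    · simp only
      omega
    · omega
  have hGarc : ∀ c ∈ G, c.1 ≤ c.2 ∧ c.2 < d + 2 := by
    intro c hc
    rcases (hmemG c).1 hc with rfl | hb
    · simp only
      omega
    · omega
  have hG : IsCoveringForest I I hI hI G := by
    refine ⟨⟨fun c hc => ?_, fun c hc => bl_lt_wh.2 (hGarc c hc).1,
      fun a ha b hb => (hcompat a (hGarc a ha).2 b hb).1⟩, ?_, fun i hi => ⟨i, ?_⟩,
      fun j hj => ⟨j, ?_⟩⟩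
    · have := hGarc c hc
      simp only [I, Finset.mem_product, Finset.mem_range]
      omega
    · rw [hmemG, rootArc, hminI, hmaxI]
      exact Or.inl rfl
    · exact (hmemG _).2 (Or.inr ⟨rfl, Finset.mem_range.1 hi⟩)
    · exact (hmemG _).2 (Or.inr ⟨rfl, Finset.mem_range.1 hj⟩)
  have hlink : Isomorphic (simplicialAssociahedronBoundary d) (link (tamariComplex I I) G) := by
    have harc : ∀ c, IsArc I I c ↔ c.1 ≤ c.2 ∧ c.2 < d + 2 := by
      intro c
      simp only [IsArc, I, Finset.mem_product, Finset.mem_range]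
      omega
    refine (isFlag_simplicialAssociahedronBoundary d).isomorphic
      (isFlag_link_tamariComplex hG.toIsForest) (fun a h => lt_irrefl _ h.1) not_crossing_self
      (fun c => (c.1, c.2 - 1)) ⟨?_, ?_, ?_⟩ ?_
    · rintro ⟨p, q⟩ ⟨h1, h2, h3⟩
      simp only [ne_eq, Prod.mk.injEq] at h1 h2 h3
      refine ⟨(harc _).2 ?_, ?_, hcompat _ ?_⟩
      · simp only
        omega
      · simp only [hmemG, Prod.mk.injEq]
        omega
      · simp only
        omega
    · rintro ⟨p, q⟩ ⟨h1, -⟩ ⟨p', q'⟩ ⟨h1', -⟩ heq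
      simp only [Prod.mk.injEq] at h1 h1' heq ⊢
      omega
    · rintro ⟨i, j⟩ ⟨h1, h2, -⟩
      rw [harc] at h1
      simp only [hmemG, Prod.mk.injEq] at h1 h2
      refine ⟨(i, j + 1), ⟨?_, ?_, ?_⟩, rfl⟩ <;> simp only [ne_eq, Prod.mk.injEq] <;> omega
    · rintro ⟨p, q⟩ ⟨p', q'⟩ ⟨h1, -⟩ ⟨h1', -⟩
      simp only [crossing_iff] at h1 h1' ⊢
      omega
  -- The two sides differ by `(i' - i) * (j' - j)`.
  have hh : IsNonCrossingHeight I I fun i j => (i : ℝ) * j := by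
    intro i _ i' _ j _ j' _ h1 _ h3
    have h1 : (i : ℝ) < i' := by exact_mod_cast bl_lt_bl.1 h1
    have h3 : (j : ℝ) < j' := by exact_mod_cast wh_lt_wh.1 h3
    nlinarith [mul_pos (sub_pos.2 h1) (sub_pos.2 h3)]
  have hpoly := isPolytope_polyhedron (hI := hI) (hJ := hI)
    (fun j _ => by rw [hminI]; exact bl_lt_wh.2 (Nat.zero_le j))
    (fun i hi => by
      rw [hmaxI]
      exact bl_lt_wh.2 (Nat.lt_succ_iff.1 (Finset.mem_range.1 hi))) hh hG
  obtain ⟨e₁⟩ := nonempty_polytopeFaces_polyhedron (hJ := hI) hh hG.toIsForest hG.left_covered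
    hG.right_covered
  obtain ⟨e₂⟩ := hlink.nonempty_orderIso
  let e : (I → ℝ) ≃L[ℝ] (Fin I.card → ℝ) :=
    (LinearEquiv.funCongrLeft ℝ ℝ I.equivFin.symm).toContinuousLinearEquiv
  obtain ⟨e₃⟩ := combinatoriallyIsomorphic_image e (polyhedron I hI (fun i j => (i : ℝ) * j) G)
  exact ⟨I.card, e '' _, hpoly.image e, ⟨e₃.symm.trans (e₁.trans e₂.symm.dual)⟩⟩

/-- A product of anti-isomorphisms of posets. -/
def piOrderIsoDual {ι : Type*} {α β : ι → Type*} [∀ k, LE (α k)] [∀ k, LE (β k)]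
    (e : ∀ k, α k ≃o (β k)ᵒᵈ) : (∀ k, α k) ≃o (∀ k, β k)ᵒᵈ where
  toFun f := OrderDual.toDual fun k => OrderDual.ofDual (e k (f k))
  invFun f k := (e k).symm (OrderDual.toDual (OrderDual.ofDual f k))
  left_inv f := funext fun k => (e k).symm_apply_apply (f k)
  right_inv _ := funext fun k => (e k).apply_symm_apply _
  map_rel_iff' := forall_congr' fun k => (e k).le_iff_le

/-- Order is reversed twice: from the cell to the link of `G`, then from each boundary complex to
its associahedron. In between, the face poset of a join, empty faces included, is the product of the
face posets. -/
theorem exists_combinatoriallyIsomorphic_pi {I J : Finset ℕ} {hJ : J.Nonempty}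
    {h : ℕ → ℕ → ℝ} {G : Finset (ℕ × ℕ)} {r : ℕ × ℕ} (hh : IsNonCrossingHeight I J h)
    (hG : IsForest I J G) (hr : r ∈ G) (hr' : ∀ c ∈ I ×ˢ J, Inside c r)
    (hGI : ∀ i ∈ I, ∃ j, (i, j) ∈ G) (hGJ : ∀ j ∈ J, ∃ i, (i, j) ∈ G) :
    ∃ (n : ℕ) (d m : Fin n → ℕ) (Q : ∀ k, Set (Fin (m k) → ℝ)),
      (∀ k, IsAssociahedron (d k) (Q k)) ∧
      CombinatoriallyIsomorphic (polyhedron J hJ h G) (Set.univ.pi Q) := by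
  obtain ⟨n, d, hiso⟩ := exists_isomorphic_link_iJoin hG hr hr' hGI hGJ
  choose m Q hQ using fun k => exists_isAssociahedron (d k)
  obtain ⟨e₁⟩ := nonempty_polytopeFaces_polyhedron (hJ := hJ) hh hG hGI hGJ
  obtain ⟨e₂⟩ := hiso.nonempty_orderIso
  have e₃ := fun k => (hQ k).2
  obtain ⟨e₄⟩ := nonempty_polytopeFaces_pi Q
  exact ⟨n, d, m, Q, hQ, ⟨e₁.trans ((e₂.trans (facePosetIJoin _)).dual.trans
    ((piOrderIsoDual fun k => (e₃ k).some).symm.trans e₄))⟩⟩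

theorem inside_rootArc {I J : Finset ℕ} {hI : I.Nonempty} {hJ : J.Nonempty} :
    ∀ c ∈ I ×ˢ J, Inside c (rootArc I J hI hJ) := fun _ hc =>
  ⟨I.min'_le _ (Finset.mem_product.1 hc).1, J.le_max' _ (Finset.mem_product.1 hc).2⟩

end Associahedra

end TamariAssoc

theorem mainTheorem8 (I J : Finset ℕ) (hI : I.Nonempty) (hJ : J.Nonempty)
    (hmin : ∀ j ∈ J, TamariAssoc.bl (I.min' hI) < TamariAssoc.wh j)
    (hmax : ∀ i ∈ I, TamariAssoc.bl i < TamariAssoc.wh (J.max' hJ)) :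
    -- the link of a forest
    (∀ F : Finset (ℕ × ℕ), TamariAssoc.IsForest I J F →
      TamariAssoc.Isomorphic
        (TamariAssoc.join (TamariAssoc.link (TamariAssoc.tamariComplex I J) F)
          (TamariAssoc.fullSimplex F))
        (TamariAssoc.join
          (TamariAssoc.iJoin fun a : {a // a ∈ F ∧ a ≠ TamariAssoc.rootArc I J hI hJ} =>
            TamariAssoc.deletion (TamariAssoc.tamariOn I J (TamariAssoc.region F a)) a)
          (TamariAssoc.tamariOn I J
            (TamariAssoc.region F (TamariAssoc.rootArc I J hI hJ))))) ∧
    -- the link of an arc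
    (∀ a ∈ I ×ˢ J, TamariAssoc.bl a.1 < TamariAssoc.wh a.2 →
      TamariAssoc.Isomorphic
        (TamariAssoc.link (TamariAssoc.tamariComplex I J) {a})
        (TamariAssoc.join
          (TamariAssoc.deletion
            (TamariAssoc.tamariOn I J (TamariAssoc.closedInterval a)) a)
          (TamariAssoc.deletion
            (TamariAssoc.tamariOn I J (TamariAssoc.openInterval a)ᶜ) a))) ∧
    -- the link of a covering forest
    (∀ F : Finset (ℕ × ℕ), TamariAssoc.IsCoveringForest I J hI hJ F →
      ∃ (r : ℕ) (d : Fin r → ℕ),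
        TamariAssoc.Isomorphic
          (TamariAssoc.link (TamariAssoc.tamariComplex I J) F)
          (TamariAssoc.iJoin fun k => TamariAssoc.simplicialAssociahedronBoundary (d k))) ∧
    -- the cells of the associahedron
    (∀ h : ℕ → ℕ → ℝ, TamariAssoc.IsNonCrossingHeight I J h →
      ∀ C ∈ TamariAssoc.associahedronCells I J hJ h,
        TamariAssoc.IsPolytope C ∧
        ∃ (r : ℕ) (d m : Fin r → ℕ) (Q : ∀ k, Set (Fin (m k) → ℝ)),
          (∀ k, TamariAssoc.IsAssociahedron (d k) (Q k)) ∧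
          TamariAssoc.CombinatoriallyIsomorphic C (Set.univ.pi Q)) := by
  have hroot : (TamariAssoc.rootArc I J hI hJ).1 ≤ (TamariAssoc.rootArc I J hI hJ).2 :=
    TamariAssoc.bl_lt_wh.1 (hmin _ (J.max'_mem hJ))
  refine ⟨fun F hF => TamariAssoc.isomorphic_link_join_fullSimplex hF hroot
    TamariAssoc.inside_rootArc, fun a ha hle => TamariAssoc.isomorphic_link_singleton
      ⟨ha, TamariAssoc.bl_lt_wh.1 hle⟩, fun F hF => TamariAssoc.exists_isomorphic_link_iJoin
        hF.toIsForest hF.root_mem TamariAssoc.inside_rootArc hF.left_covered hF.right_covered,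
    fun h hh C hC => ?_⟩
  obtain ⟨G, hG, rfl⟩ := TamariAssoc.exists_coveringForest_of_mem_cells (hI := hI) hh hC
  exact ⟨TamariAssoc.isPolytope_polyhedron hmin hmax hh hG,
    TamariAssoc.exists_combinatoriallyIsomorphic_pi hh hG.toIsForest hG.root_mem
      TamariAssoc.inside_rootArc hG.left_covered hG.right_covered⟩
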